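/- Let $k$ be a field of characteristic $0$ and let $R$ be a Cohen--Macaulay local ring that is a $k$-algebra essentially of finite type (that is, a localization of a finitely generated $k$-algebra), with maximal ideal $\mathfrak m$ and canonical module $\omega_R$. Write $\mathrm{D}_{R/k}$ for the $R$-module of $k$-derivations $R\to R$, $N^\vee=\mathrm{Hom}_R(N,\omega_R)$ for an $R$-module $N$, and $\Omega_1^R M$ for the first syzygy module of a finitely generated $R$-module $M$, i.e. the image of the first differential of a minimal free resolution of $M$ (equivalently, the kernel of a surjection $\pi\colon F_0\to M$ with $F_0$ free of finite rank and $\ker\pi\subseteq\mathfrak mF_0$). Depth means $\mathfrak m$-depth, with $\operatorname{depth}0=+\infty$. A finitely generated $R$-module $N$ is maximal Cohen--Macaulay if $\operatorname{depth}N=\dim R$. Let $N$ be a maximal Cohen--Macaulay $R$-module. (1) Suppose that $$\operatorname{depth}\bigl(\Omega_1^R\mathrm{D}_{R/k}\otimes_R N^\vee\bigr)\neq \operatorname{depth}\bigl(\mathrm{D}_{R/k}\otimes_R N^\vee\bigr)+1 .$$ If $\mathrm{D}_{R/k}$ has finite projective dimension over $R$, then $\mathrm{D}_{R/k}$ is a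 free $R$-module. (So the Herzog--Vasconcelos conjecture, which predicts that $\mathrm{D}_{R/k}$ is free whenever $\mathrm{pd}_R\mathrm{D}_{R/k}<\infty$, holds for $R$ as soon as such an $N$ exists.) (2) The depth condition in (1) is satisfied whenever $\mathrm{D}_{R/k}\otimes_R N^\vee$ is maximal Cohen--Macaulay. -/

import Mathlib

universe u v w

open CategoryTheory TensorProduct

section Depth

variable (R : Type u) [CommRing R] [IsLocalRing R]
variable (M : Type v) [AddCommGroup M] [Module R M]

open Classical in
/-- The depth of a module over a local ring `(R, 𝔪)`: the supremum of the lengths of the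
`M`-regular sequences contained in `𝔪`, with value `⊤` if `𝔪 M = M` (for finitely generated `M`
this means `M = 0`). -/
noncomputable def moduleDepth : ℕ∞ :=
  if IsLocalRing.maximalIdeal R • (⊤ : Submodule R M) = ⊤ then ⊤
  else ⨆ rs ∈ {rs : List R | (∀ r ∈ rs, r ∈ IsLocalRing.maximalIdeal R) ∧
    RingTheory.Sequence.IsRegular M rs}, (rs.length : ℕ∞)

/-- Maximal Cohen-Macaulay modules: finitely generated, with depth equal to `dim R`. -/
structure IsMaximalCohenMacaulay : Prop where
  finite : Module.Finite R M
  depth_eq : (moduleDepth R M : WithBot ℕ∞) = ringKrullDim R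

/-- A (Noetherian) local ring is Cohen-Macaulay if its depth equals its dimension. -/
def IsCohenMacaulayLocalRing : Prop :=
  (moduleDepth R R : WithBot ℕ∞) = ringKrullDim R

end Depth

section Canonical

variable (R : Type u) [CommRing R] [IsLocalRing R]

/-- A canonical module of a local ring `(R, 𝔪, κ)`: a maximal Cohen-Macaulay module of finite
injective dimension and of type one, i.e. `Ext^t_R(κ, ω)` is one-dimensional over `κ`
for `t = depth ω`. -/
structure IsCanonicalModule (ω : Type u) [AddCommGroup ω] [Module R ω] : Prop where
  maximalCohenMacaulay : IsMaximalCohenMacaulay R ω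
  injectiveDimension_lt_top : injectiveDimension (ModuleCat.of R ω) < ⊤
  type_one : ∃ t : ℕ, moduleDepth R ω = t ∧
    Nonempty (Abelian.Ext (ModuleCat.of R (IsLocalRing.ResidueField R)) (ModuleCat.of R ω) t
      ≃ₗ[R] IsLocalRing.ResidueField R)

/-- The dual `N^∨ = Hom_R(N, ω)` with respect to `ω`. -/
abbrev canonicalDual (ω : Type v) [AddCommGroup ω] [Module R ω]
    (N : Type w) [AddCommGroup N] [Module R N] : Type (max v w) :=
  N →ₗ[R] ω

end Canonical

section Syzygy

variable {R : Type u} [CommRing R] [IsLocalRing R]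
variable {M : Type v} [AddCommGroup M] [Module R M]

/-- A surjection `π : Rⁿ → M` with `ker π ⊆ 𝔪 Rⁿ`: the augmentation `F₀ → M` of a minimal free
resolution of `M`. -/
structure IsMinimalFreeCover {n : ℕ} (π : (Fin n → R) →ₗ[R] M) : Prop where
  surjective : Function.Surjective π
  ker_le : LinearMap.ker π ≤ IsLocalRing.maximalIdeal R • (⊤ : Submodule R (Fin n → R))

variable (R M)

theorem exists_isMinimalFreeCover [Module.Finite R M] :
    ∃ p : (n : ℕ) × ((Fin n → R) →ₗ[R] M), IsMinimalFreeCover p.2 := by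
  let b := Module.finBasis (IsLocalRing.ResidueField R) (IsLocalRing.ResidueField R ⊗[R] M)
  choose f hf using fun i => TensorProduct.mk_surjective R M (IsLocalRing.ResidueField R)
    Ideal.Quotient.mk_surjective (b i)
  refine ⟨⟨_, Fintype.linearCombination R f⟩, ?_, ?_⟩
  · rw [← LinearMap.range_eq_top, Fintype.range_linearCombination]
    exact IsLocalRing.span_eq_top_of_tmul_eq_basis f b hf
  · intro x hx
    have hx' : ∑ i, x i • f i = 0 := by
      simpa [Fintype.linearCombination_apply] using hx
    have h2 : ∑ i, (IsLocalRing.residue R (x i)) • b i = 0 := by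
      have := congrArg (TensorProduct.mk R (IsLocalRing.ResidueField R) M 1) hx'
      rw [map_sum, map_zero] at this
      rw [← this]
      refine Finset.sum_congr rfl fun i _ => ?_
      rw [map_smul, hf]
      exact algebraMap_smul (IsLocalRing.ResidueField R) (x i) (b i)
    have h3 := Fintype.linearIndependent_iff.mp b.linearIndependent _ h2
    have hmem : ∀ i, x i ∈ IsLocalRing.maximalIdeal R := fun i =>
      (IsLocalRing.residue_eq_zero_iff _).mp (h3 i)
    rw [pi_eq_sum_univ' x]
    refine Submodule.sum_mem _ fun i _ => ?_
    exact Submodule.smul_mem_smul (hmem i) Submodule.mem_top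

/-- The first syzygy module `Ω₁ M` of a finitely generated module `M` over a local ring: the
kernel of the augmentation `F₀ → M` of a minimal free resolution (equivalently, the image of its
first differential `F₁ → F₀`). -/
noncomputable def firstSyzygy [Module.Finite R M] :
    Submodule R (Fin (exists_isMinimalFreeCover R M).choose.1 → R) :=
  LinearMap.ker (exists_isMinimalFreeCover R M).choose.2

end Syzygy

/-- The derivation module of an algebra essentially of finite type over a field is finitely
generated. -/
instance derivation_finite (k : Type v) [Field k] (R : Type u) [CommRing R] [Algebra k R]
    [Algebra.EssFiniteType k R] : Module.Finite R (Derivation k R R) := by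
  have : IsNoetherianRing R := Algebra.EssFiniteType.isNoetherianRing k R
  exact Module.Finite.equiv (KaehlerDifferential.linearMapEquivDerivation k R)

/-! The argument concerns an arbitrary finitely generated module `M` of finite projective dimension
and `T = Hom(N, ω)`: if `M` is not free and `T ≠ 0`, then `depth (Ω₁M ⊗ T) = depth (M ⊗ T) + 1`.
Part (1) is the contrapositive for `M = Der_k(R)`; if `T = 0`, both depths are `⊤` and the excluded
equality holds anyway.

The depth equality (`moduleDepth_firstSyzygy_tensor`) rests on two facts. The first is
Tor-independence: `0 → Ω₁M ⊗ T → F ⊗ T → M ⊗ T → 0` stays exact. The second is the strict inequality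
`depth (M ⊗ T) < depth T` (`moduleDepth_tensor_lt`). Together they put the sequence in the range
where the depth lemma gives an equality. The inequality follows by induction on projective
dimension; at the last nontrivial syzygy, minimality makes `Ext(κ, -)` of the first map zero, where
`κ` is the residue field.

Tor-independence uses duality for `ω`. Finite injective dimension gives `Ext^i(-, ω) = 0` on
finitely generated modules for `i > d = dim R`, hence `Ext^i(N, ω) = 0` for `i > 0` and `N` maximal
Cohen-Macaulay. Type one gives `End(ω) = R` (`canonical_homothety`), by a length count modulo a
maximal `ω`-regular sequence. Consequently `M → Hom(ω, M ⊗ ω)` is bijective for `M` of finite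
projective dimension, which forces `Tor_1(M, ω) = 0`. Dualizing a free presentation of `N` transfers
this to `T` (`rTensor_ker_subtype_injective_dual`).

For part (2), the equality would force depth `d + 1` or `⊤ = d + 1`; both are impossible. -/

/-! ### Vanishing of Ext along retracts, short exact sequences and finite powers -/

section ExtVanishing

open Abelian

variable (R : Type u) [CommRing R]

/-- The vanishing of `Ext^n_R(X, Y)`. -/
abbrev ExtVanish (X Y : Type u) [AddCommGroup X] [Module R X] [AddCommGroup Y] [Module R Y]
    (n : ℕ) : Prop :=
  Subsingleton (Ext (ModuleCat.of R X) (ModuleCat.of R Y) n)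

variable {R}
variable {A B C X Y : Type u} [AddCommGroup A] [Module R A] [AddCommGroup B] [Module R B]
  [AddCommGroup C] [Module R C] [AddCommGroup X] [Module R X] [AddCommGroup Y] [Module R Y]

theorem extVanish_zero_iff : ExtVanish R X Y 0 ↔ Subsingleton (X →ₗ[R] Y) :=
  (Ext.linearEquiv₀ (R := R)).toEquiv.subsingleton_congr.trans
    (ModuleCat.homLinearEquiv (S := R)).toEquiv.subsingleton_congr

theorem extVanish_of_projective [Module.Projective R X] (i : ℕ) : ExtVanish R X Y (i + 1) :=
  Ext.subsingleton_of_projective _ _ i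

theorem ExtVanish.of_retract_right {i : ℕ} (h : ExtVanish R X B i) (s : A →ₗ[R] B) (p : B →ₗ[R] A)
    (hps : p ∘ₗ s = LinearMap.id) : ExtVanish R X A i := by
  refine subsingleton_of_forall_eq 0 fun e => ?_
  have h1 : ModuleCat.ofHom s ≫ ModuleCat.ofHom p = 𝟙 (ModuleCat.of R A) := by
    rw [← ModuleCat.ofHom_comp, hps]; rfl
  rw [← e.comp_mk₀_id, ← h1, ← Ext.mk₀_comp_mk₀, ← Ext.comp_assoc_of_third_deg_zero,
    h.elim (e.comp (Ext.mk₀ (ModuleCat.ofHom s)) (add_zero i)) 0, Ext.zero_comp]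

theorem ExtVanish.of_retract_left {i : ℕ} (h : ExtVanish R B Y i) (s : A →ₗ[R] B) (p : B →ₗ[R] A)
    (hps : p ∘ₗ s = LinearMap.id) : ExtVanish R A Y i := by
  refine subsingleton_of_forall_eq 0 fun e => ?_
  have h1 : ModuleCat.ofHom s ≫ ModuleCat.ofHom p = 𝟙 (ModuleCat.of R A) := by
    rw [← ModuleCat.ofHom_comp, hps]; rfl
  rw [← e.mk₀_id_comp, ← h1, ← Ext.mk₀_comp_mk₀_assoc,
    h.elim ((Ext.mk₀ (ModuleCat.ofHom p)).comp e (zero_add i)) 0, Ext.comp_zero]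

theorem ExtVanish.congr_right {i : ℕ} (h : ExtVanish R X B i) (e : A ≃ₗ[R] B) :
    ExtVanish R X A i :=
  h.of_retract_right e.toLinearMap e.symm.toLinearMap (by ext; simp)

theorem ExtVanish.congr_left {i : ℕ} (h : ExtVanish R B Y i) (e : A ≃ₗ[R] B) :
    ExtVanish R A Y i :=
  h.of_retract_left e.toLinearMap e.symm.toLinearMap (by ext; simp)

theorem exists_comp_eq_of_exact {f : A →ₗ[R] B} {g : B →ₗ[R] C} (hf : Function.Injective f)
    (hfg : Function.Exact f g) {φ : X →ₗ[R] B} (h : g ∘ₗ φ = 0) : ∃ ψ : X →ₗ[R] A, f ∘ₗ ψ = φ := by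
  have hmem : ∀ x, φ x ∈ LinearMap.range f := fun x =>
    (hfg (φ x)).mp (LinearMap.congr_fun h x)
  refine ⟨(LinearEquiv.ofInjective f hf).symm.toLinearMap ∘ₗ φ.codRestrict _ hmem, ?_⟩
  ext x
  exact congrArg Subtype.val
    ((LinearEquiv.ofInjective f hf).apply_symm_apply (φ.codRestrict _ hmem x))

theorem smul_ext_eq_zero_of_left {r : R} (hr : ∀ x : X, r • x = 0) {i : ℕ}
    (e : Ext (ModuleCat.of R X) (ModuleCat.of R Y) i) : r • e = 0 := by
  have h0 : r • 𝟙 (ModuleCat.of R X) = 0 := by ext x; exact hr x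
  have : r • e = (Ext.mk₀ (r • 𝟙 (ModuleCat.of R X))).comp e (zero_add i) := by
    rw [Ext.mk₀_smul, Ext.smul_comp, Ext.mk₀_id_comp]
  rw [this, h0, Ext.mk₀_zero, Ext.zero_comp]

section

variable {f : A →ₗ[R] B} {g : B →ₗ[R] C}

/-- The short complex of a pair of linear maps that is exact in the middle. -/
abbrev exactShortComplex (hfg : Function.Exact f g) : ShortComplex (ModuleCat.{u} R) :=
  ModuleCat.shortComplexOfCompEqZero f g hfg.linearMap_comp_eq_zero

theorem exactShortComplex_shortExact (hf : Function.Injective f) (hfg : Function.Exact f g)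
    (hg : Function.Surjective g) : (exactShortComplex hfg).ShortExact :=
  ModuleCat.shortComplex_shortExact _ hfg hf hg

theorem ExtVanish.cov_zero (h : ExtVanish R X B 0) (hf : Function.Injective f) :
    ExtVanish R X A 0 := by
  rw [extVanish_zero_iff] at h ⊢
  refine subsingleton_of_forall_eq 0 fun a => ?_
  ext x
  exact hf (by simpa using LinearMap.congr_fun (h.elim (f ∘ₗ a) 0) x)

variable (hf : Function.Injective f) (hfg : Function.Exact f g) (hg : Function.Surjective g)

include hf hfg hg

theorem ExtVanish.cov_left {i : ℕ} (hC : ExtVanish R X C i) (hB : ExtVanish R X B (i + 1)) :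
    ExtVanish R X A (i + 1) := by
  refine subsingleton_of_forall_eq 0 fun e => ?_
  obtain ⟨x, hx⟩ := Ext.covariant_sequence_exact₁ (ModuleCat.of R X)
    (exactShortComplex_shortExact hf hfg hg) e (hB.elim _ _) rfl
  rw [← hx, hC.elim x 0, Ext.zero_comp]

theorem ExtVanish.cov_mid {i : ℕ} (hA : ExtVanish R X A i) (hC : ExtVanish R X C i) :
    ExtVanish R X B i := by
  refine subsingleton_of_forall_eq 0 fun e => ?_
  obtain ⟨x, hx⟩ := Ext.covariant_sequence_exact₂ (ModuleCat.of R X)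
    (exactShortComplex_shortExact hf hfg hg) e (hC.elim _ _)
  rw [← hx, hA.elim x 0, Ext.zero_comp]

theorem ExtVanish.cov_right {i : ℕ} (hB : ExtVanish R X B i) (hA : ExtVanish R X A (i + 1)) :
    ExtVanish R X C i := by
  refine subsingleton_of_forall_eq 0 fun e => ?_
  obtain ⟨x, hx⟩ := Ext.covariant_sequence_exact₃ (ModuleCat.of R X)
    (exactShortComplex_shortExact hf hfg hg) e rfl (hA.elim _ _)
  rw [← hx, hB.elim x 0, Ext.zero_comp]

theorem ExtVanish.contra_left {i : ℕ} (hB : ExtVanish R B Y i) (hC : ExtVanish R C Y (i + 1)) :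
    ExtVanish R A Y i := by
  refine subsingleton_of_forall_eq 0 fun e => ?_
  obtain ⟨x, hx⟩ := Ext.contravariant_sequence_exact₁
    (exactShortComplex_shortExact hf hfg hg) (ModuleCat.of R Y) e (add_comm 1 i) (hC.elim _ _)
  rw [← hx, hB.elim x 0, Ext.comp_zero]

theorem ExtVanish.contra_mid {i : ℕ} (hA : ExtVanish R A Y i) (hC : ExtVanish R C Y i) :
    ExtVanish R B Y i := by
  refine subsingleton_of_forall_eq 0 fun e => ?_
  obtain ⟨x, hx⟩ := Ext.contravariant_sequence_exact₂
    (exactShortComplex_shortExact hf hfg hg) (ModuleCat.of R Y) e (hA.elim _ _)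
  rw [← hx, hC.elim x 0, Ext.comp_zero]

theorem ExtVanish.contra_right {i : ℕ} (hA : ExtVanish R A Y i) (hB : ExtVanish R B Y (i + 1)) :
    ExtVanish R C Y (i + 1) := by
  refine subsingleton_of_forall_eq 0 fun e => ?_
  obtain ⟨x, hx⟩ := Ext.contravariant_sequence_exact₃
    (exactShortComplex_shortExact hf hfg hg) (ModuleCat.of R Y) e (hB.elim _ _) (add_comm 1 i)
  rw [← hx, hA.elim x 0, Ext.comp_zero]

/-- If `Ext^1(X, A)` vanishes then linear maps `X → C` lift along `B → C`. -/
theorem ExtVanish.exists_lift (hA : ExtVanish R X A 1) (φ : X →ₗ[R] C) :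
    ∃ ψ : X →ₗ[R] B, g ∘ₗ ψ = φ := by
  obtain ⟨x, hx⟩ := Ext.covariant_sequence_exact₃ (ModuleCat.of R X)
    (exactShortComplex_shortExact hf hfg hg) (Ext.mk₀ (ModuleCat.ofHom φ)) (zero_add 1)
    (hA.elim _ _)
  obtain ⟨ψ, rfl⟩ := (Ext.mk₀_bijective _ _).2 x
  rw [Ext.mk₀_comp_mk₀] at hx
  have h := (Ext.mk₀_bijective _ _).1 hx
  exact ⟨ψ.hom, congrArg ModuleCat.Hom.hom h⟩

/-- If `Ext^1(C, Y)` vanishes then linear maps `A → Y` extend along `A → B`. -/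
theorem ExtVanish.exists_extend (hC : ExtVanish R C Y 1) (φ : A →ₗ[R] Y) :
    ∃ ψ : B →ₗ[R] Y, ψ ∘ₗ f = φ := by
  obtain ⟨x, hx⟩ := Ext.contravariant_sequence_exact₁
    (exactShortComplex_shortExact hf hfg hg) (ModuleCat.of R Y) (Ext.mk₀ (ModuleCat.ofHom φ))
    (add_zero 1) (hC.elim _ _)
  obtain ⟨ψ, rfl⟩ := (Ext.mk₀_bijective _ _).2 x
  rw [Ext.mk₀_comp_mk₀] at hx
  have h := (Ext.mk₀_bijective _ _).1 hx
  exact ⟨ψ.hom, congrArg ModuleCat.Hom.hom h⟩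

end

theorem ExtVanish.pi_fin {i : ℕ} (h : ExtVanish R X Y i) (n : ℕ) :
    ExtVanish R X (Fin n → Y) i := by
  induction n with
  | zero =>
    refine h.of_retract_right (0 : (Fin 0 → Y) →ₗ[R] Y) 0 ?_
    refine LinearMap.ext fun x => funext fun j => ?_
    exact j.elim0
  | succ n ih =>
    have hf : Function.Injective (LinearMap.single R (fun _ : Fin (n + 1) => Y) 0) :=
      Pi.single_injective (M := fun _ : Fin (n + 1) => Y) 0
    refine ExtVanish.cov_mid (f := LinearMap.single R (fun _ : Fin (n + 1) => Y) 0)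
      (g := LinearMap.funLeft R Y Fin.succ) hf ?_
      (LinearMap.funLeft_surjective_of_injective _ _ _ (Fin.succ_injective n)) h ih
    intro y
    constructor
    · intro hy
      refine ⟨y 0, ?_⟩
      ext j
      refine Fin.cases ?_ (fun j => ?_) j
      · simp
      · simpa using (congrFun hy j).symm
    · rintro ⟨y, rfl⟩
      ext j
      simp [LinearMap.funLeft_apply]

theorem ExtVanish.of_pi_fin {i n : ℕ} (h : ExtVanish R X (Fin n → Y) i) (hn : n ≠ 0) :
    ExtVanish R X Y i := by
  obtain ⟨n, rfl⟩ := Nat.exists_eq_succ_of_ne_zero hn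
  refine h.of_retract_right (LinearMap.single R (fun _ : Fin (n + 1) => Y) 0)
    (LinearMap.proj 0) ?_
  ext; simp

end ExtVanishing

/-! ### Depth as the first nonvanishing `Ext(κ, -)`, and its bound by the dimension -/

section DepthExt

open Abelian IsLocalRing RingTheory.Sequence

variable {R : Type u} [CommRing R]
variable {M X Y : Type u} [AddCommGroup M] [Module R M] [AddCommGroup X] [Module R X]
  [AddCommGroup Y] [Module R Y]

open Pointwise in
/-- If `r` is regular on `M` and `Ext^{i+1}(M/rM, Y)` vanishes, then so does `Ext^i(M, Y)`. -/
theorem ExtVanish.of_quotSMulTop_left [IsLocalRing R] [IsNoetherianRing R] [Module.Finite R M]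
    [Module.Finite R Y] {r : R} (hr : r ∈ maximalIdeal R) (hreg : IsSMulRegular M r) {i : ℕ}
    (h : ExtVanish R (QuotSMulTop r M) Y (i + 1)) : ExtVanish R M Y i := by
  by_contra hn
  rw [not_subsingleton_iff_nontrivial] at hn
  have hj : r ∈ (Module.annihilator R (Ext (ModuleCat.of R M) (ModuleCat.of R Y) i)).jacobson :=
    IsLocalRing.maximalIdeal_le_jacobson _ hr
  -- The long exact sequence makes multiplication by `r` surjective on this finitely generated Ext,
  -- against Nakayama.
  refine Submodule.top_ne_pointwise_smul_of_mem_jacobson_annihilator hj ?_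
  rw [eq_comm, eq_top_iff]
  intro y _
  obtain ⟨z, rfl⟩ := Ext.contravariant_sequence_exact₁
    (exactShortComplex_shortExact (f := LinearMap.lsmul R M r) hreg (LinearMap.exact_lsmul_mkQ_smul_top M r)
      (Submodule.mkQ_surjective _)) (ModuleCat.of R Y) y (add_comm 1 i) (h.elim _ _)
  have h1 : (Ext.mk₀ (exactShortComplex (LinearMap.exact_lsmul_mkQ_smul_top M r)).f).comp z
      (zero_add i) = r • z := by
    have : (exactShortComplex (LinearMap.exact_lsmul_mkQ_smul_top M r)).f
      = r • 𝟙 (ModuleCat.of R M) := rfl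
    rw [this, Ext.mk₀_smul, Ext.smul_comp, Ext.mk₀_id_comp]
  rw [h1]
  exact Submodule.smul_mem_pointwise_smul _ _ ⊤ trivial

theorem comp_mk₀_lsmul {r : R} {i : ℕ} (e : Ext (ModuleCat.of R X) (ModuleCat.of R M) i) :
    e.comp (Ext.mk₀ (exactShortComplex (LinearMap.exact_lsmul_mkQ_smul_top M r)).f)
      (add_zero i) = r • e := by
  have : (exactShortComplex (LinearMap.exact_lsmul_mkQ_smul_top M r)).f
    = r • 𝟙 (ModuleCat.of R M) := rfl
  rw [this, ← Ext.smul_eq_comp_mk₀]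

theorem ExtVanish.of_isRegular [IsNoetherianRing R] [Module.Finite R X] [Module.Finite R M]
    {rs : List R} (hrs : IsRegular M rs) (hX : ∀ r ∈ rs, ∀ x : X, r • x = 0) {i : ℕ}
    (hi : i < rs.length) : ExtVanish R X M i := by
  refine ModuleCat.subsingleton_ext_of_exists_isRegular (Ideal.ofList rs) (ModuleCat.of R X) ?_
    (ModuleCat.of R M) (lt_top_iff_ne_top.mpr fun h => hrs.2 h.symm) rs
    (fun r hr => Ideal.subset_span hr) hrs i hi
  rw [Module.support_eq_zeroLocus, PrimeSpectrum.zeroLocus_subset_zeroLocus_iff]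
  refine le_trans ?_ Ideal.le_radical
  exact Ideal.span_le.mpr fun r hr => Module.mem_annihilator.mpr (hX r hr)

variable [IsLocalRing R]

theorem maximalIdeal_smul_residueField {r : R} (hr : r ∈ maximalIdeal R) (x : ResidueField R) :
    r • x = 0 := by
  rw [Algebra.smul_def]
  have : algebraMap R (ResidueField R) r = 0 := (residue_eq_zero_iff r).mpr hr
  rw [this, zero_mul]

theorem smul_top_ne_top_of_nontrivial [Module.Finite R M] [Nontrivial M] :
    maximalIdeal R • (⊤ : Submodule R M) ≠ ⊤ := fun h =>
  Submodule.top_ne_ideal_smul_of_le_jacobson_annihilator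
    (IsLocalRing.maximalIdeal_le_jacobson (Module.annihilator R M)) h.symm

variable (R M) in
theorem moduleDepth_of_subsingleton [Subsingleton M] : moduleDepth R M = ⊤ :=
  if_pos (Subsingleton.elim _ _)

variable (R M) in
theorem moduleDepth_of_nontrivial [Module.Finite R M] [Nontrivial M] :
    moduleDepth R M = ⨆ rs ∈ {rs : List R | (∀ r ∈ rs, r ∈ maximalIdeal R) ∧ IsRegular M rs},
      (rs.length : ℕ∞) :=
  if_neg smul_top_ne_top_of_nontrivial

theorem exists_isRegular_of_le_moduleDepth [Module.Finite R M] [Nontrivial M] {n : ℕ}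
    (h : (n : ℕ∞) ≤ moduleDepth R M) :
    ∃ rs : List R, n ≤ rs.length ∧ (∀ r ∈ rs, r ∈ maximalIdeal R) ∧ IsRegular M rs := by
  by_contra! hcon
  rcases n with _ | n
  · exact hcon [] (by simp) (by simp) (IsRegular.nil R M)
  · have : moduleDepth R M ≤ n := by
      rw [moduleDepth_of_nontrivial]
      refine iSup₂_le fun rs hrs => ?_
      by_contra hlt
      rw [not_le, Nat.cast_lt] at hlt
      exact hcon rs hlt hrs.1 hrs.2
    have := h.trans this
    rw [Nat.cast_le] at this
    omega

theorem length_le_moduleDepth [Module.Finite R M] {rs : List R}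
    (hrs : ∀ r ∈ rs, r ∈ maximalIdeal R) (h : IsRegular M rs) :
    (rs.length : ℕ∞) ≤ moduleDepth R M := by
  have := h.nontrivial
  rw [moduleDepth_of_nontrivial]
  exact le_iSup₂_of_le rs ⟨hrs, h⟩ le_rfl

/-- Rees's characterization of depth. It turns every later depth estimate into a chase in a long
exact Ext sequence; the zero module fits because its depth is `⊤`. -/
theorem le_moduleDepth_iff [IsNoetherianRing R] [Module.Finite R M] {n : ℕ} :
    (n : ℕ∞) ≤ moduleDepth R M ↔ ∀ i < n, ExtVanish R (ResidueField R) M i := by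
  rcases subsingleton_or_nontrivial M with hM | hM
  · rw [moduleDepth_of_subsingleton]
    refine iff_of_true le_top fun i _ => ?_
    have hz : Limits.IsZero (ModuleCat.of R M) := ModuleCat.isZero_of_subsingleton _
    refine subsingleton_of_forall_eq 0 fun e => ?_
    rw [← e.comp_mk₀_id, hz.eq_of_src (𝟙 _) 0, Ext.mk₀_zero, Ext.comp_zero]
  · constructor
    · intro h i hi
      obtain ⟨rs, hlen, hmem, hreg⟩ := exists_isRegular_of_le_moduleDepth h
      exact ExtVanish.of_isRegular hreg
        (fun r hr x => maximalIdeal_smul_residueField (hmem r hr) x) (hi.trans_le hlen)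
    · intro h
      have hsupp : Module.support R (ResidueField R) =
          PrimeSpectrum.zeroLocus (maximalIdeal R : Set R) := by
        have : Module.Finite R (ResidueField R) :=
          Module.Finite.of_surjective (Algebra.linearMap R (ResidueField R)) residue_surjective
        rw [Module.support_eq_zeroLocus]
        congr 2
        exact Ideal.annihilator_quotient
      obtain ⟨rs, rfl, hmem, hreg⟩ := ModuleCat.exists_isRegular_of_exists_subsingleton_ext
        (maximalIdeal R) n (ModuleCat.of R M)
        (lt_top_iff_ne_top.mpr smul_top_ne_top_of_nontrivial)
        (ModuleCat.of R (ResidueField R)) hsupp h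
      exact length_le_moduleDepth hmem hreg

theorem exists_isRegular_length_eq_of_moduleDepth_eq [IsNoetherianRing R] [Module.Finite R M]
    {n : ℕ} (h : moduleDepth R M = n) :
    ∃ rs : List R, rs.length = n ∧ (∀ r ∈ rs, r ∈ maximalIdeal R) ∧ IsRegular M rs := by
  have : Nontrivial M := by
    rw [← not_subsingleton_iff_nontrivial]
    intro hM
    rw [moduleDepth_of_subsingleton] at h
    exact ENat.top_ne_natCast n h
  obtain ⟨rs, hlen, hmem, hreg⟩ := exists_isRegular_of_le_moduleDepth h.ge
  refine ⟨rs, le_antisymm ?_ hlen, hmem, hreg⟩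
  exact Nat.cast_le.mp ((length_le_moduleDepth hmem hreg).trans h.le)

theorem not_extVanish_of_moduleDepth_eq [IsNoetherianRing R] [Module.Finite R M] {n : ℕ}
    (h : moduleDepth R M = n) : ¬ ExtVanish R (ResidueField R) M n := by
  intro hn
  have : ((n + 1 : ℕ) : ℕ∞) ≤ moduleDepth R M := by
    refine le_moduleDepth_iff.mpr fun i hi => ?_
    rcases Nat.lt_succ_iff_lt_or_eq.mp hi with hi | rfl
    · exact le_moduleDepth_iff.mp h.ge i hi
    · exact hn
  rw [h, Nat.cast_le] at this
  omega

theorem moduleDepth_eq_of_extVanish [IsNoetherianRing R] [Module.Finite R M] {n : ℕ}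
    (h : ∀ i < n, ExtVanish R (ResidueField R) M i) (hn : ¬ ExtVanish R (ResidueField R) M n) :
    moduleDepth R M = n := by
  refine le_antisymm ?_ (le_moduleDepth_iff.mpr h)
  by_contra hlt
  rw [not_le] at hlt
  have h1 : ((n + 1 : ℕ) : ℕ∞) ≤ moduleDepth R M := by
    exact_mod_cast Order.add_one_le_of_lt hlt
  exact hn (le_moduleDepth_iff.mp h1 n (Nat.lt_succ_self n))

/-- Each term of a regular sequence lowers the dimension of the support by one, and the final
quotient is nonzero, so its dimension is at least `0`. -/
theorem moduleDepth_le_ringKrullDim [IsNoetherianRing R] [Module.Finite R M] [Nontrivial M] :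
    (moduleDepth R M : WithBot ℕ∞) ≤ ringKrullDim R := by
  obtain ⟨d, hd⟩ : ∃ d : ℕ∞, ringKrullDim R = d := by
    refine WithBot.ne_bot_iff_exists.mp ringKrullDim_ne_bot |>.imp fun _ => Eq.symm
  rw [hd, WithBot.coe_le_coe, moduleDepth_of_nontrivial]
  refine iSup₂_le fun rs hrs => ?_
  have h1 := Module.supportDim_add_length_eq_supportDim_of_isRegular rs hrs.2
  have h2 := Module.supportDim_le_ringKrullDim R M
  have h3 := hrs.2.quot_ofList_smul_nontrivial ⊤
  have h4 : 0 ≤ Module.supportDim R (M ⧸ Ideal.ofList rs • (⊤ : Submodule R M)) := by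
    have h5 : Module.supportDim R (M ⧸ Ideal.ofList rs • (⊤ : Submodule R M)) ≠ ⊥ :=
      Module.supportDim_ne_bot_of_nontrivial R _
    obtain ⟨c, hc⟩ := WithBot.ne_bot_iff_exists.mp h5
    rw [← hc]
    exact WithBot.coe_le_coe.mpr bot_le
  rw [← WithBot.coe_le_coe, ← hd]
  refine le_trans ?_ h2
  rw [← h1]
  exact le_add_of_nonneg_left h4

theorem ringKrullDim_eq_coe_nat [IsNoetherianRing R] : ∃ d : ℕ, ringKrullDim R = (d : ℕ∞) := by
  obtain ⟨d, hd⟩ := WithBot.ne_bot_iff_exists.mp (ringKrullDim_ne_bot (R := R))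
  have h : d ≠ ⊤ := by
    rintro rfl
    exact ringKrullDim_ne_top hd.symm
  obtain ⟨n, rfl⟩ := ENat.ne_top_iff_exists.mp h
  exact ⟨n, hd.symm⟩

end DepthExt

/-! ### Change of rings along regular sequences, and the bound on injective dimension -/

section InjectiveDimension

open Abelian IsLocalRing RingTheory.Sequence

variable {R : Type u} [CommRing R]
variable {M X Y : Type u} [AddCommGroup M] [Module R M] [AddCommGroup X] [Module R X]
  [AddCommGroup Y] [Module R Y]

theorem ExtVanish.quotient_left {c : ℕ} {rs : List R} (hrs : IsWeaklyRegular M rs)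
    (h : ∀ j > c, ExtVanish R M Y j) :
    ∀ j > c + rs.length, ExtVanish R (M ⧸ (Ideal.ofList rs • ⊤ : Submodule R M)) Y j := by
  induction rs generalizing M c with
  | nil =>
    intro j hj
    refine (h j hj).congr_left (Submodule.quotEquivOfEqBot _ ?_)
    rw [Ideal.ofList_nil, Submodule.bot_smul]
  | cons r rs ih =>
    intro j hj
    rw [isWeaklyRegular_cons_iff] at hrs
    refine (ih hrs.2 (c := c + 1) (fun i hi => ?_) j ?_).congr_left
      (Submodule.quotOfListConsSMulTopEquivQuotSMulTopInner M r rs)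
    · obtain ⟨i, rfl⟩ := Nat.exists_eq_succ_of_ne_zero (n := i) (by omega)
      exact ExtVanish.contra_right (f := LinearMap.lsmul R M r) hrs.1
        (LinearMap.exact_lsmul_mkQ_smul_top M r) (Submodule.mkQ_surjective _)
        (h i (by omega)) (h (i + 1) (by omega))
    · simp only [List.length_cons] at hj
      omega

/-- Since `r` kills `X`, it acts as zero on `Ext(X, M)`, so the connecting map from `Ext(X, M/rM)`
is surjective; iterate. -/
theorem ExtVanish.of_quotient_right {i : ℕ} {rs : List R} (hrs : IsWeaklyRegular M rs)
    (hX : ∀ r ∈ rs, ∀ x : X, r • x = 0)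
    (h : ExtVanish R X (M ⧸ (Ideal.ofList rs • ⊤ : Submodule R M)) i) :
    ExtVanish R X M (i + rs.length) := by
  induction rs generalizing M with
  | nil =>
    refine ExtVanish.congr_right h (Submodule.quotEquivOfEqBot _ ?_).symm
    rw [Ideal.ofList_nil, Submodule.bot_smul]
  | cons r rs ih =>
    rw [isWeaklyRegular_cons_iff] at hrs
    have h1 := ih hrs.2 (fun s hs => hX s (List.mem_cons_of_mem _ hs))
      (h.congr_right (Submodule.quotOfListConsSMulTopEquivQuotSMulTopInner M r rs).symm)
    refine subsingleton_of_forall_eq 0 fun e => ?_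
    obtain ⟨x, rfl⟩ := Ext.covariant_sequence_exact₁ (ModuleCat.of R X)
      (exactShortComplex_shortExact (f := LinearMap.lsmul R M r) hrs.1
        (LinearMap.exact_lsmul_mkQ_smul_top M r) (Submodule.mkQ_surjective _)) e
      (by rw [comp_mk₀_lsmul]; exact smul_ext_eq_zero_of_left (hX r List.mem_cons_self) e)
      (n₀ := i + rs.length) (by simp; omega)
    rw [h1.elim x 0, Ext.zero_comp]

/-- The connecting maps `Ext^n(X, M/rM) → Ext^{n+1}(X, M)` are injective, because `Ext^n(X, M) = 0`
below the length of the sequence. With `X = κ` this bounds the socle of `ω/(rs)ω` by the type of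
`ω`. -/
theorem length_ext_le_of_isRegular [IsNoetherianRing R] [Module.Finite R X] [Module.Finite R M]
    {rs : List R} (hrs : IsRegular M rs) (hX : ∀ r ∈ rs, ∀ x : X, r • x = 0) :
    Module.length R (Ext (ModuleCat.of R X)
      (ModuleCat.of R (M ⧸ (Ideal.ofList rs • ⊤ : Submodule R M))) 0) ≤
    Module.length R (Ext (ModuleCat.of R X) (ModuleCat.of R M) rs.length) := by
  generalize hn : rs.length = n
  induction n generalizing M rs with
  | zero =>
    obtain rfl := List.length_eq_zero_iff.mp hn
    let e : (M ⧸ (Ideal.ofList ([] : List R) • ⊤ : Submodule R M)) ≃ₗ[R] M :=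
      Submodule.quotEquivOfEqBot _ (by rw [Ideal.ofList_nil, Submodule.bot_smul])
    refine Module.length_le_of_injective
      ((Ext.mk₀ (ModuleCat.ofHom e.toLinearMap)).postcompOfLinear R _ (add_zero 0)) ?_
    have : Mono (ModuleCat.ofHom e.toLinearMap) := (ModuleCat.mono_iff_injective _).mpr e.injective
    exact Ext.postcomp_mk₀_injective_of_mono _ _
  | succ n ih =>
    rcases rs with _ | ⟨r, rs⟩
    · simp at hn
    have hlen : rs.length = n := by simpa using hn
    have h0 : ExtVanish R X M n := ExtVanish.of_isRegular hrs hX (by omega)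
    rw [isRegular_cons_iff] at hrs
    have h1 := ih hrs.2 (fun s hs => hX s (List.mem_cons_of_mem _ hs)) hlen
    let e := Submodule.quotOfListConsSMulTopEquivQuotSMulTopInner M r rs
    have h2 : Module.length R (Ext (ModuleCat.of R X)
      (ModuleCat.of R (M ⧸ (Ideal.ofList (r :: rs) • ⊤ : Submodule R M))) 0) ≤ _ :=
      Module.length_le_of_injective
        ((Ext.mk₀ (ModuleCat.ofHom e.toLinearMap)).postcompOfLinear R (ModuleCat.of R X)
          (add_zero 0)) (by
        have : Mono (ModuleCat.ofHom e.toLinearMap) :=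
          (ModuleCat.mono_iff_injective _).mpr e.injective
        exact Ext.postcomp_mk₀_injective_of_mono _ _)
    refine (h2.trans h1).trans ?_
    have hS := exactShortComplex_shortExact (f := LinearMap.lsmul R M r) hrs.1
        (LinearMap.exact_lsmul_mkQ_smul_top M r) (Submodule.mkQ_surjective _)
    refine Module.length_le_of_injective
      (hS.extClass.postcompOfLinear R (ModuleCat.of R X) rfl) ?_
    rw [← LinearMap.ker_eq_bot, LinearMap.ker_eq_bot']
    intro x hx
    obtain ⟨y, rfl⟩ := Ext.covariant_sequence_exact₃ (ModuleCat.of R X) hS x rfl hx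
    rw [h0.elim y 0, Ext.zero_comp]

/-- A linear map into `M/(rs)M` extends from `X` to `Y`, where `rs` annihilates both modules, if
classes in `Ext^n(X, M)` extend for `n` the length of the `M`-regular sequence `rs`. -/
theorem exists_extend_of_isRegular [IsNoetherianRing R] [Module.Finite R X] [Module.Finite R M]
    {rs : List R} (hrs : IsRegular M rs) (hX : ∀ r ∈ rs, ∀ x : X, r • x = 0)
    (hY : ∀ r ∈ rs, ∀ y : Y, r • y = 0) (j : X →ₗ[R] Y)
    (h : ∀ a : Ext (ModuleCat.of R X) (ModuleCat.of R M) rs.length,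
      ∃ b : Ext (ModuleCat.of R Y) (ModuleCat.of R M) rs.length,
        (Ext.mk₀ (ModuleCat.ofHom j)).comp b (zero_add _) = a)
    (φ : X →ₗ[R] M ⧸ (Ideal.ofList rs • ⊤ : Submodule R M)) :
    ∃ ψ : Y →ₗ[R] M ⧸ (Ideal.ofList rs • ⊤ : Submodule R M), ψ ∘ₗ j = φ := by
  generalize hn : rs.length = n at h
  induction n generalizing M rs with
  | zero =>
    obtain rfl := List.length_eq_zero_iff.mp hn
    let e : (M ⧸ (Ideal.ofList ([] : List R) • ⊤ : Submodule R M)) ≃ₗ[R] M :=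
      Submodule.quotEquivOfEqBot _ (by rw [Ideal.ofList_nil, Submodule.bot_smul])
    obtain ⟨b, hb⟩ := h (Ext.mk₀ (ModuleCat.ofHom (e.toLinearMap ∘ₗ φ)))
    obtain ⟨ψ, rfl⟩ := (Ext.mk₀_bijective _ _).2 b
    rw [Ext.mk₀_comp_mk₀] at hb
    have h1 := congrArg ModuleCat.Hom.hom ((Ext.mk₀_bijective _ _).1 hb)
    refine ⟨e.symm.toLinearMap ∘ₗ ψ.hom, ?_⟩
    ext x
    apply e.injective
    simpa using LinearMap.congr_fun h1 x
  | succ n ih =>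
    rcases rs with _ | ⟨r, rs⟩
    · simp at hn
    have hlen : rs.length = n := by simpa using hn
    have h0 : ExtVanish R X M n := ExtVanish.of_isRegular hrs hX (by omega)
    rw [isRegular_cons_iff] at hrs
    let e := Submodule.quotOfListConsSMulTopEquivQuotSMulTopInner M r rs
    have hS := exactShortComplex_shortExact (f := LinearMap.lsmul R M r) hrs.1
        (LinearMap.exact_lsmul_mkQ_smul_top M r) (Submodule.mkQ_surjective _)
    obtain ⟨ψ, hψ⟩ := ih hrs.2 (fun s hs => hX s (List.mem_cons_of_mem _ hs))
      (fun s hs => hY s (List.mem_cons_of_mem _ hs)) (e.toLinearMap ∘ₗ φ) hlen (by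
        intro a
        -- Extend the image of `a` under the connecting map, then pull back. The extension `b` comes
        -- from some `c`, as `r` kills `Ext(Y, M)`; and `c` restricts to `a`, as the connecting map
        -- for `X` is injective by `h0`.
        obtain ⟨b, hb⟩ := h (a.comp hS.extClass rfl)
        obtain ⟨c, hc⟩ := Ext.covariant_sequence_exact₁ (ModuleCat.of R Y) hS b
          (by rw [comp_mk₀_lsmul]; exact smul_ext_eq_zero_of_left (hY r List.mem_cons_self) b)
          (n₀ := n) rfl
        refine ⟨c, ?_⟩
        rw [← sub_eq_zero]
        obtain ⟨y, hy⟩ := Ext.covariant_sequence_exact₃ (ModuleCat.of R X) hS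
          ((Ext.mk₀ (ModuleCat.ofHom j)).comp c (zero_add _) - a) (n₁ := n + 1) rfl (by
            rw [sub_eq_add_neg, Ext.add_comp, Ext.neg_comp, Ext.comp_assoc (h₂₃ := rfl), hc, hb,
              add_neg_cancel]
            omega)
        rw [← hy, h0.elim y 0, Ext.zero_comp])
    refine ⟨e.symm.toLinearMap ∘ₗ ψ, ?_⟩
    ext x
    apply e.injective
    simpa using LinearMap.congr_fun hψ x

variable [IsLocalRing R] [IsNoetherianRing R]

instance finite_residueField : Module.Finite R (ResidueField R) :=
  Module.Finite.of_surjective (Algebra.linearMap R (ResidueField R)) residue_surjective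

instance isSimpleModule_residueField : IsSimpleModule R (ResidueField R) :=
  isSimpleModule_iff_quot_maximal.mpr ⟨maximalIdeal R, inferInstance, ⟨LinearEquiv.refl R _⟩⟩

omit [IsNoetherianRing R] in
theorem mem_maximalIdeal_of_mem_annihilator [Nontrivial X] {r : R}
    (hr : r ∈ Module.annihilator R X) : r ∈ maximalIdeal R := by
  rw [mem_maximalIdeal, mem_nonunits_iff]
  intro hu
  obtain ⟨x, hx⟩ := exists_ne (0 : X)
  exact hx ((hu.smul_eq_zero).mp (Module.mem_annihilator.mp hr x))

/-- Were the socle of `M/(rs)M` zero, `Ext^n(κ, M)` would vanish at `n = depth M`. A nonzero map out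
of the simple module `κ` is injective. -/
theorem exists_injective_residueField_quotient [Module.Finite R M] {rs : List R}
    (hrs : IsRegular M rs) (hmem : ∀ r ∈ rs, r ∈ maximalIdeal R)
    (hd : moduleDepth R M = rs.length) :
    ∃ f : ResidueField R →ₗ[R] M ⧸ (Ideal.ofList rs • ⊤ : Submodule R M),
      Function.Injective f := by
  by_contra! hcon
  refine not_extVanish_of_moduleDepth_eq hd ?_
  rw [← zero_add rs.length]
  refine ExtVanish.of_quotient_right hrs.toIsWeaklyRegular
    (fun r hr => maximalIdeal_smul_residueField (hmem r hr)) ?_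
  rw [extVanish_zero_iff]
  exact subsingleton_of_forall_eq 0 fun f => f.injective_or_eq_zero.resolve_left (hcon f)

/-- Over a Cohen-Macaulay local ring of dimension `d`, a finitely generated module of finite
injective dimension satisfies `Ext^i(X, Y) = 0` for `i > d` and `X` finitely generated. -/
theorem extVanish_of_injectiveDimension_lt_top [Module.Finite R Y] {d n : ℕ}
    (hd : moduleDepth R R = d) [HasInjectiveDimensionLT (ModuleCat.of R Y) n]
    [Module.Finite R X] {i : ℕ} (hi : d < i) : ExtVanish R X Y i := by
  -- Descending induction on `i`, starting from the a priori bound `n`; `m` bounds how far `i` may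
  -- lie below it.
  suffices H : ∀ m : ℕ, ∀ i, d < i → n ≤ i + m → ∀ (X : Type u) [AddCommGroup X] [Module R X]
      [Module.Finite R X], ExtVanish R X Y i from H n i hi (by omega) X
  intro m
  induction m with
  | zero =>
    intro i _ hn X _ _ _
    exact HasInjectiveDimensionLT.subsingleton _ n i (by omega) _
  | succ m ih =>
    intro i hi hn X _ _ hX
    have hsucc : ∀ (X : Type u) [AddCommGroup X] [Module R X] [Module.Finite R X],
      ExtVanish R X Y (i + 1) := ih (i + 1) (by omega) (by omega)
    -- Embed `κ` in `R/(rs)` for a maximal `R`-regular sequence `rs`. The Koszul-type bound gives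
    -- `Ext^i(R/(rs), Y) = 0`, and `Ext^{i+1}` of the cokernel vanishes by induction.
    have hres : ExtVanish R (ResidueField R) Y i := by
      obtain ⟨rs, hlen, hmem, hreg⟩ := exists_isRegular_length_eq_of_moduleDepth_eq hd
      obtain ⟨f, hf⟩ := exists_injective_residueField_quotient hreg hmem (hd.trans (by rw [hlen]))
      refine ExtVanish.contra_left hf (LinearMap.exact_map_mkQ_range f)
        (Submodule.mkQ_surjective _) ?_ (hsucc _)
      refine ExtVanish.quotient_left (c := 0) hreg.toIsWeaklyRegular (fun j hj => ?_) i (by omega)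
      obtain ⟨j, rfl⟩ := Nat.exists_eq_succ_of_ne_zero hj.ne'
      exact extVanish_of_projective j
    -- Prime filtration: for `p ≠ 𝔪`, any `r ∈ 𝔪 \ p` is regular on `R/p`, and Nakayama reduces to
    -- degree `i + 1`.
    refine IsNoetherianRing.induction_on_isQuotientEquivQuotientPrime R hX
      (motive := fun N _ _ _ => ExtVanish R N Y i) ?_ ?_ ?_
    · intro N _ _ _ _
      exact hres.of_retract_left 0 0 (Subsingleton.elim _ _)
    · intro N _ _ _ p e
      by_cases hp : maximalIdeal R ≤ p.asIdeal
      · have hp' : p.asIdeal = maximalIdeal R :=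
          ((maximalIdeal.isMaximal R).eq_of_le p.2.ne_top hp).symm
        exact hres.congr_left (e.trans (Submodule.quotEquivOfEq _ _ hp'))
      · obtain ⟨r, hr, hrp⟩ := SetLike.not_le_iff_exists.mp hp
        refine ExtVanish.congr_left ?_ e
        refine ExtVanish.of_quotSMulTop_left hr ?_ (hsucc _)
        rw [isSMulRegular_iff_right_eq_zero_of_smul]
        intro x hx
        obtain ⟨x, rfl⟩ := Ideal.Quotient.mk_surjective x
        rw [← Ideal.Quotient.mk_eq_mk, ← Submodule.Quotient.mk_smul, Ideal.Quotient.mk_eq_mk,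
          Ideal.Quotient.eq_zero_iff_mem, smul_eq_mul] at hx
        exact Ideal.Quotient.eq_zero_iff_mem.mpr ((p.2.mem_or_mem hx).resolve_left hrp)
    · intro N₁ _ _ _ N₂ _ _ _ N₃ _ _ _ f g hf hg hfg h1 h3
      exact h1.contra_mid hf hfg hg h3

/-- Each regular element on `X` lowers the vanishing bound by one, by Nakayama. With `d` elements,
the case of maximal Cohen-Macaulay `X`, every positive degree is covered. -/
theorem ExtVanish.of_isWeaklyRegular_left [Module.Finite R Y] {d : ℕ}
    (h : ∀ (X : Type u) [AddCommGroup X] [Module R X] [Module.Finite R X],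
      ∀ i > d, ExtVanish R X Y i) [Module.Finite R X] {rs : List R}
    (hmem : ∀ r ∈ rs, r ∈ maximalIdeal R) (hrs : IsWeaklyRegular X rs) {i : ℕ}
    (hi : d < i + rs.length) : ExtVanish R X Y i := by
  induction rs generalizing X i with
  | nil => exact h X i hi
  | cons r rs ih =>
    rw [isWeaklyRegular_cons_iff] at hrs
    simp only [List.mem_cons, forall_eq_or_imp] at hmem
    refine ExtVanish.of_quotSMulTop_left hmem.1 hrs.1 (ih hmem.2 hrs.2 ?_)
    simp only [List.length_cons] at hi
    omega

end InjectiveDimension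

/-! ### Endomorphisms of the canonical module -/

section CanonicalEndomorphisms

open Abelian IsLocalRing RingTheory.Sequence Pointwise

variable {R : Type u} [CommRing R] [IsLocalRing R] [IsNoetherianRing R]
variable {M V W E : Type u} [AddCommGroup M] [Module R M] [AddCommGroup V] [Module R V]
  [AddCommGroup W] [Module R W] [AddCommGroup E] [Module R E]

omit [IsLocalRing R] [IsNoetherianRing R] in
theorem exists_smul_eq_of_forall_smul_eq {y : R} {φ : V →ₗ[R] W} (hy : IsSMulRegular W y)
    (h : (y • (⊤ : Submodule R W)).mkQ ∘ₗ φ = 0) : ∃ ψ : V →ₗ[R] W, φ = y • ψ := by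
  obtain ⟨ψ, hψ⟩ := exists_comp_eq_of_exact (f := LinearMap.lsmul R W y) hy
    (LinearMap.exact_lsmul_mkQ_smul_top W y) h
  exact ⟨ψ, hψ.symm⟩

/-- If every linear map `V → W/(rs)W` is a multiple of the reduction of `π : V → W`, then every
linear map `V → W` is a multiple of `π`; similarly for the annihilator of `π`. -/
theorem homothety_lift [Module.Finite R V] [Module.Finite R W] (π : V →ₗ[R] W) (I : Ideal R)
    (hI : ∀ r ∈ I, r • π = 0) {rs : List R} (hmem : ∀ r ∈ rs, r ∈ maximalIdeal R)
    (hrs : IsWeaklyRegular W rs)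
    (h1 : ∀ φ : V →ₗ[R] W ⧸ (Ideal.ofList rs • ⊤ : Submodule R W), ∃ r : R,
      φ = r • ((Ideal.ofList rs • ⊤ : Submodule R W).mkQ ∘ₗ π))
    (h2 : ∀ r : R, r • ((Ideal.ofList rs • ⊤ : Submodule R W).mkQ ∘ₗ π) = 0 →
      r ∈ I ⊔ Ideal.ofList rs) :
    (∀ φ : V →ₗ[R] W, ∃ r : R, φ = r • π) ∧ (∀ r : R, r • π = 0 → r ∈ I) := by
  induction rs generalizing W I with
  | nil =>
    have hbot : (Ideal.ofList ([] : List R) • ⊤ : Submodule R W) = ⊥ := by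
      rw [Ideal.ofList_nil, Submodule.bot_smul]
    have hinj : Function.Injective (Ideal.ofList ([] : List R) • ⊤ : Submodule R W).mkQ := by
      rw [← LinearMap.ker_eq_bot, Submodule.ker_mkQ, hbot]
    constructor
    · intro φ
      obtain ⟨r, hr⟩ := h1 ((Ideal.ofList ([] : List R) • ⊤ : Submodule R W).mkQ ∘ₗ φ)
      refine ⟨r, ?_⟩
      ext v
      exact hinj (LinearMap.congr_fun hr v)
    · intro r hr
      have := h2 r (by rw [← LinearMap.comp_smul, hr, LinearMap.comp_zero])
      rwa [Ideal.ofList_nil, sup_bot_eq] at this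
  | cons y rs ih =>
    rw [isWeaklyRegular_cons_iff] at hrs
    simp only [List.mem_cons, forall_eq_or_imp] at hmem
    set q : W →ₗ[R] QuotSMulTop y W := (y • (⊤ : Submodule R W)).mkQ with hq
    let e := Submodule.quotOfListConsSMulTopEquivQuotSMulTopInner W y rs
    have he : e.toLinearMap ∘ₗ (Ideal.ofList (y :: rs) • ⊤ : Submodule R W).mkQ =
        (Ideal.ofList rs • ⊤ : Submodule R (QuotSMulTop y W)).mkQ ∘ₗ q := by
      ext w; rfl
    have hyq : y • q = 0 := by
      ext w
      exact (LinearMap.exact_lsmul_mkQ_smul_top W y _).mpr ⟨w, rfl⟩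
    -- Over `W/yW` the element `y` also annihilates the map, so the ideal must be allowed to grow
    -- along the induction.
    obtain ⟨k1, k2⟩ := ih (W := QuotSMulTop y W) (q ∘ₗ π) (I ⊔ Ideal.span {y}) (by
        intro r hr
        obtain ⟨a, ha, b, hb, rfl⟩ := Submodule.mem_sup.mp hr
        obtain ⟨c, rfl⟩ := Ideal.mem_span_singleton'.mp hb
        rw [add_smul, ← LinearMap.comp_smul, hI a ha, LinearMap.comp_zero, zero_add, mul_smul,
          ← LinearMap.smul_comp, hyq, LinearMap.zero_comp, smul_zero]) hmem.2 hrs.2 (by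
        intro φ
        obtain ⟨r, hr⟩ := h1 (e.symm.toLinearMap ∘ₗ φ)
        refine ⟨r, ?_⟩
        rw [← LinearMap.comp_assoc, ← he, LinearMap.comp_assoc, ← LinearMap.comp_smul, ← hr]
        ext v; simp) (by
        intro r hr
        have := h2 r (by
          rw [← LinearMap.comp_assoc, ← he, LinearMap.comp_assoc, ← LinearMap.comp_smul] at hr
          ext v
          apply e.injective
          simpa using LinearMap.congr_fun hr v)
        rwa [Ideal.ofList_cons, ← sup_assoc] at this)
    constructor
    · have hle : (⊤ : Submodule R (V →ₗ[R] W)) ≤ Submodule.span R {π} := by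
        refine Submodule.le_of_le_smul_of_le_jacobson_bot (I := maximalIdeal R)
          Module.Finite.fg_top (IsLocalRing.maximalIdeal_le_jacobson _) ?_
        intro φ _
        obtain ⟨r, hr⟩ := k1 (q ∘ₗ φ)
        obtain ⟨ψ, hψ⟩ := exists_smul_eq_of_forall_smul_eq (φ := φ - r • π) hrs.1 (by
          rw [LinearMap.comp_sub, LinearMap.comp_smul, ← hr, sub_self])
        rw [← sub_add_cancel φ (r • π), hψ, add_comm]
        exact Submodule.add_mem_sup (Submodule.smul_mem _ _ (Submodule.mem_span_singleton_self π))
          (Submodule.smul_mem_smul hmem.1 trivial)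
      intro φ
      obtain ⟨r, hr⟩ := Submodule.mem_span_singleton.mp (hle (Submodule.mem_top (x := φ)))
      exact ⟨r, hr.symm⟩
    -- Nakayama modulo `I`: an annihilator `r` of `π` has the form `a + cy` with `a ∈ I`, and
    -- regularity of `y` shows that `c` annihilates `π` too.
    · have hle : LinearMap.ker (LinearMap.toSpanSingleton R (V →ₗ[R] W) π) ≤ I := by
        refine Submodule.le_of_le_smul_of_le_jacobson_bot (I := maximalIdeal R)
          (IsNoetherian.noetherian _) (IsLocalRing.maximalIdeal_le_jacobson _) ?_
        intro r hr
        have hr' : r • π = 0 := hr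
        have h3 := k2 r (by rw [← LinearMap.comp_smul, hr', LinearMap.comp_zero])
        obtain ⟨a, ha, b, hb, rfl⟩ := Submodule.mem_sup.mp h3
        obtain ⟨c, rfl⟩ := Ideal.mem_span_singleton'.mp hb
        refine Submodule.add_mem_sup ha ?_
        rw [mul_comm]
        refine Submodule.smul_mem_smul hmem.1 ?_
        rw [add_smul, hI a ha, zero_add, mul_comm, mul_smul] at hr'
        show c • π = 0
        ext v
        refine hrs.1 ?_
        simpa using LinearMap.congr_fun hr' v
      exact fun r hr => hle hr

omit [IsNoetherianRing R] in
-- Left exactness of `Hom(-, E)` along a composition series: each simple factor is `κ` and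
-- contributes at most `1`.
theorem length_hom_le_of_isFiniteLength
    (hE : Module.length R (ResidueField R →ₗ[R] E) ≤ 1) {X : Type u} [AddCommGroup X] [Module R X]
    (hX : IsFiniteLength R X) : Module.length R (X →ₗ[R] E) ≤ Module.length R X := by
  induction hX with
  | @of_subsingleton X _ _ _ =>
    have : Subsingleton (X →ₗ[R] E) := ⟨fun f g => LinearMap.ext fun x => by
      rw [Subsingleton.elim x 0, map_zero, map_zero]⟩
    simp
  | @of_simple_quotient X _ _ N _ _ ih =>
    obtain ⟨m, hm, ⟨e⟩⟩ := isSimpleModule_iff_quot_maximal.mp ‹IsSimpleModule R (X ⧸ N)›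
    obtain rfl := IsLocalRing.eq_maximalIdeal hm
    have h1 : Module.length R (X ⧸ N →ₗ[R] E) ≤ 1 := by
      refine le_trans (le_of_eq ?_) hE
      exact (LinearEquiv.congrLeft E R e).length_eq
    have h2 : Module.length R X = Module.length R N + Module.length R (X ⧸ N) :=
      Module.length_eq_add_of_exact N.subtype N.mkQ N.subtype_injective N.mkQ_surjective
        (LinearMap.exact_subtype_mkQ N)
    have h3 : Module.length R (X ⧸ N) = 1 := Module.length_eq_one_iff.mpr inferInstance
    let res : (X →ₗ[R] E) →ₗ[R] (N →ₗ[R] E) := LinearMap.lcomp R E N.subtype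
    let inc : (X ⧸ N →ₗ[R] E) →ₗ[R] (X →ₗ[R] E) := LinearMap.lcomp R E N.mkQ
    have h4 : Module.length R (X →ₗ[R] E) =
        Module.length R (X ⧸ N →ₗ[R] E) + Module.length R (LinearMap.range res) := by
      refine Module.length_eq_add_of_exact inc res.rangeRestrict ?_
        (LinearMap.surjective_rangeRestrict _) ?_
      · intro a b hab
        exact LinearMap.cancel_right N.mkQ_surjective |>.mp hab
      · intro a
        constructor
        · intro ha
          have ha' : a ∘ₗ N.subtype = 0 := congrArg Subtype.val ha
          have hle : N ≤ LinearMap.ker a := fun x hx => LinearMap.congr_fun ha' ⟨x, hx⟩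
          refine ⟨N.liftQ a hle, ?_⟩
          exact N.liftQ_mkQ a hle
        · rintro ⟨b, rfl⟩
          apply Subtype.ext
          ext x
          show b (N.mkQ x) = 0
          rw [Submodule.mkQ_apply, (Submodule.Quotient.mk_eq_zero N).mpr x.2, map_zero]
    rw [h4, h2, h3, add_comm (Module.length R N)]
    exact add_le_add h1 ((Module.length_le_of_injective _
      (LinearMap.range res).subtype_injective).trans ih)

variable {ω : Type u} [AddCommGroup ω] [Module R ω] [Module.Finite R ω] {d : ℕ}

omit [IsLocalRing R] [IsNoetherianRing R] in
theorem smul_quotient_ofList_eq_zero {rs : List R} {r : R} (hr : r ∈ rs)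
    (x : M ⧸ (Ideal.ofList rs • ⊤ : Submodule R M)) : r • x = 0 := by
  obtain ⟨x, rfl⟩ := Submodule.Quotient.mk_surjective _ x
  rw [← Submodule.Quotient.mk_smul, Submodule.Quotient.mk_eq_zero]
  exact Submodule.smul_mem_smul (Ideal.subset_span hr) trivial

/-- Faithfulness of `ω/aω` over `R/a`, where `a = (rs)`. A nonzero ideal `X = (r)` of `R/a` has a
nonzero map to `ω/aω`; this extends to `R/a` because `Ext^{d+1}(-, ω) = 0`. If `r` killed `ω/aω`,
the extension would vanish at `r`, a contradiction. -/
theorem mem_ofList_of_smul_mkQ_eq_zero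
    (hvan : ∀ (X : Type u) [AddCommGroup X] [Module R X] [Module.Finite R X],
      ∀ i > d, ExtVanish R X ω i)
    {rs : List R} (hmem : ∀ r ∈ rs, r ∈ maximalIdeal R) (hrs : IsRegular ω rs)
    (hlen : rs.length = d) (hdepth : moduleDepth R ω = d) {r : R}
    (hr : r • (Ideal.ofList rs • ⊤ : Submodule R ω).mkQ = 0) : r ∈ Ideal.ofList rs := by
  by_contra hcon
  set a := Ideal.ofList rs with ha
  let X : Submodule R (R ⧸ a) := Submodule.span R {Submodule.Quotient.mk r}
  have hY : ∀ s ∈ rs, ∀ y : R ⧸ a, s • y = 0 := by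
    intro s hs y
    obtain ⟨y, rfl⟩ := Submodule.Quotient.mk_surjective _ y
    rw [← Submodule.Quotient.mk_smul, Submodule.Quotient.mk_eq_zero]
    exact a.mul_mem_right _ (Ideal.subset_span hs)
  have hX : ∀ s ∈ rs, ∀ x : X, s • x = 0 := fun s hs x => Subtype.ext (hY s hs x)
  have hr0 : (Submodule.Quotient.mk r : R ⧸ a) ≠ 0 := by
    rwa [Ne, Submodule.Quotient.mk_eq_zero]
  have hmemX : (Submodule.Quotient.mk r : R ⧸ a) ∈ X := Submodule.mem_span_singleton_self _
  have hXnt : Nontrivial X := ⟨⟨⟨_, hmemX⟩, 0, fun h => hr0 (congrArg Subtype.val h)⟩⟩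
  obtain ⟨φ, hφ⟩ : ∃ φ : X →ₗ[R] ω ⧸ (a • ⊤ : Submodule R ω), φ ≠ 0 := by
    by_contra! hzero
    have h1 : Subsingleton (X →ₗ[R] ω ⧸ (a • ⊤ : Submodule R ω)) := subsingleton_of_forall_eq 0 hzero
    -- If Hom vanishes, some `s` annihilates `X` and is regular on `ω/aω`. As `X ≠ 0`, `s` lies in
    -- `𝔪`, so `ω/aω` has no socle, against maximality of `rs`.
    obtain ⟨s, hs, hreg⟩ := IsSMulRegular.subsingleton_linearMap_iff.mp h1
    have hsm := mem_maximalIdeal_of_mem_annihilator hs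
    have h2 : Subsingleton (ResidueField R →ₗ[R] ω ⧸ (a • ⊤ : Submodule R ω)) :=
      IsSMulRegular.subsingleton_linearMap_iff.mpr
        ⟨s, Module.mem_annihilator.mpr (maximalIdeal_smul_residueField hsm), hreg⟩
    obtain ⟨f, hf⟩ := exists_injective_residueField_quotient hrs hmem (hdepth.trans (by rw [hlen]))
    have : f = 0 := h2.elim _ _
    exact one_ne_zero (hf (by simp [this]) : (1 : ResidueField R) = 0)
  obtain ⟨ψ, hψ⟩ := exists_extend_of_isRegular hrs hX hY X.subtype (by
    intro b
    exact Ext.contravariant_sequence_exact₁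
      (exactShortComplex_shortExact X.subtype_injective (LinearMap.exact_subtype_mkQ X)
        X.mkQ_surjective) (ModuleCat.of R ω) b (add_comm 1 _)
        ((hvan _ _ (by omega)).elim _ _)) φ
  apply hφ
  rw [← hψ]
  ext ⟨x, hx⟩
  obtain ⟨t, rfl⟩ := Submodule.mem_span_singleton.mp hx
  obtain ⟨w, hw⟩ := Submodule.mkQ_surjective _ (ψ (Submodule.Quotient.mk 1))
  have h3 : (Submodule.Quotient.mk r : R ⧸ a) = r • Submodule.Quotient.mk 1 := by
    rw [← Submodule.Quotient.mk_smul, smul_eq_mul, mul_one]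
  have h4 : r • (a • ⊤ : Submodule R ω).mkQ w = 0 := LinearMap.congr_fun hr w
  show ψ (t • Submodule.Quotient.mk r) = 0
  rw [h3, map_smul, map_smul, ← hw, h4, smul_zero]

/-- A length count with `E = ω/aω`. Type one gives `ℓ(Hom(κ, E)) ≤ 1`, so `ℓ(Hom(ω, E)) ≤ ℓ(Hom(E,
E)) ≤ ℓ(E) ≤ ℓ(R/a)`. By faithfulness the multiples of the projection already form a copy of `R/a`,
hence they are everything. -/
theorem exists_eq_smul_mkQ
    (hvan : ∀ (X : Type u) [AddCommGroup X] [Module R X] [Module.Finite R X],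
      ∀ i > d, ExtVanish R X ω i)
    {rs : List R} (hmem : ∀ r ∈ rs, r ∈ maximalIdeal R) (hrs : IsRegular ω rs)
    (hlen : rs.length = d) (hdepth : moduleDepth R ω = d) (hdim : ringKrullDim R = (d : ℕ∞))
    (htype : Nonempty (Ext (ModuleCat.of R (ResidueField R)) (ModuleCat.of R ω) d
      ≃ₗ[R] ResidueField R)) :
    ∀ φ : ω →ₗ[R] ω ⧸ (Ideal.ofList rs • ⊤ : Submodule R ω),
      ∃ r : R, φ = r • (Ideal.ofList rs • ⊤ : Submodule R ω).mkQ := by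
  set a := Ideal.ofList rs with ha
  let E := ω ⧸ (a • ⊤ : Submodule R ω)
  have hann : Module.annihilator R E = a := by
    refine le_antisymm (fun r hr => ?_) (Ideal.span_le.mpr fun r hr => ?_)
    · refine mem_ofList_of_smul_mkQ_eq_zero hvan hmem hrs hlen hdepth ?_
      ext w
      exact Module.mem_annihilator.mp hr _
    · exact Module.mem_annihilator.mpr (smul_quotient_ofList_eq_zero hr)
  have hE1 : Module.length R (ResidueField R →ₗ[R] E) ≤ 1 := by
    have h1 := length_ext_le_of_isRegular (X := ResidueField R) hrs
      (fun r hr => maximalIdeal_smul_residueField (hmem r hr))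
    rw [hlen] at h1
    obtain ⟨e⟩ := htype
    rw [e.length_eq, Module.length_eq_one R (ResidueField R)] at h1
    rwa [((Ext.linearEquiv₀ (R := R)).trans (ModuleCat.homLinearEquiv (S := R))).length_eq] at h1
  -- The `d` regular elements cut `dim ω ≤ d` down to `0`, and `E` has annihilator `a`, so `R/a` is
  -- Artinian.
  have hfl : IsFiniteLength R (R ⧸ a) := by
    have hdim0 : ringKrullDim (R ⧸ a) ≤ 0 := by
      have h1 := Module.supportDim_add_length_eq_supportDim_of_isRegular rs hrs
      have h2 := (Module.supportDim_le_ringKrullDim R ω).trans hdim.le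
      rw [← h1, hlen, Module.supportDim_eq_ringKrullDim_quotient_annihilator, hann] at h2
      refine (ENat.WithBot.add_le_add_natCast_right_iff (c := d)).mp ?_
      simpa using h2
    have : IsArtinianRing (R ⧸ a) := by
      refine isArtinianRing_iff_isNoetherianRing_krullDimLE_zero.mpr ⟨inferInstance, ?_⟩
      exact Ring.krullDimLE_iff.mpr (by simpa using hdim0)
    rw [← Module.length_ne_top_iff,
      Module.length_eq_of_surjective (S := R) (R := R ⧸ a) Ideal.Quotient.mk_surjective]
    exact Module.length_ne_top
  have hlE : Module.length R E ≤ Module.length R (R ⧸ a) := by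
    refine le_trans ?_ (length_hom_le_of_isFiniteLength hE1 hfl)
    let Φ : E →ₗ[R] (R ⧸ a →ₗ[R] E) :=
      { toFun := fun x => a.liftQ (LinearMap.toSpanSingleton R E x) fun r hr => by
          rw [← hann] at hr
          exact Module.mem_annihilator.mp hr x
        map_add' := fun x y => by
          refine Submodule.linearMap_qext _ (LinearMap.ext_ring ?_)
          show (1 : R) • (x + y) = (1 : R) • x + (1 : R) • y
          rw [smul_add]
        map_smul' := fun r x => by
          refine Submodule.linearMap_qext _ (LinearMap.ext_ring ?_)
          show (1 : R) • (r • x) = r • ((1 : R) • x)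
          rw [one_smul, one_smul] }
    refine Module.length_le_of_injective Φ fun x y hxy => ?_
    have h1 : (1 : R) • x = (1 : R) • y := LinearMap.congr_fun hxy (Submodule.Quotient.mk 1)
    rwa [one_smul, one_smul] at h1
  have hlE' : IsFiniteLength R E := by
    rw [← Module.length_ne_top_iff] at hfl ⊢
    exact (hlE.trans_lt hfl.lt_top).ne
  have hHom : Module.length R (ω →ₗ[R] E) ≤ Module.length R (R ⧸ a) := by
    refine le_trans ?_ ((length_hom_le_of_isFiniteLength hE1 hlE').trans hlE)
    refine Module.length_le_of_surjective (LinearMap.lcomp R E (a • ⊤ : Submodule R ω).mkQ) ?_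
    intro f
    have hle : (a • ⊤ : Submodule R ω) ≤ LinearMap.ker f := by
      refine Submodule.smul_le.mpr fun r hr x _ => ?_
      rw [← hann] at hr
      rw [LinearMap.mem_ker, map_smul]
      exact Module.mem_annihilator.mp hr _
    exact ⟨(a • ⊤ : Submodule R ω).liftQ f hle, Submodule.liftQ_mkQ _ f hle⟩
  let π : ω →ₗ[R] E := (a • ⊤ : Submodule R ω).mkQ
  have hker : LinearMap.ker (LinearMap.toSpanSingleton R (ω →ₗ[R] E) π) = a := by
    refine le_antisymm (fun r hr =>
      mem_ofList_of_smul_mkQ_eq_zero hvan hmem hrs hlen hdepth hr) fun r hr => ?_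
    rw [← hann] at hr
    ext w
    exact Module.mem_annihilator.mp hr _
  have hrange : Module.length R (LinearMap.range (LinearMap.toSpanSingleton R (ω →ₗ[R] E) π)) =
      Module.length R (R ⧸ a) := by
    rw [← (LinearMap.quotKerEquivRange _).length_eq, hker]
  have htop : LinearMap.range (LinearMap.toSpanSingleton R (ω →ₗ[R] E) π) = ⊤ := by
    by_contra hne
    have h1 : IsFiniteLength R (ω →ₗ[R] E) := by
      rw [← Module.length_ne_top_iff] at hfl ⊢
      exact (hHom.trans_lt hfl.lt_top).ne
    obtain ⟨_, _⟩ := isFiniteLength_iff_isNoetherian_isArtinian.mp h1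
    exact absurd (Submodule.length_lt hne) (not_lt.mpr (hHom.trans hrange.ge))
  intro φ
  obtain ⟨r, hr⟩ := LinearMap.range_eq_top.mp htop φ
  exact ⟨r, hr.symm⟩

/-- The endomorphisms of a canonical module are the homotheties, and it is faithful. -/
theorem canonical_homothety
    (hvan : ∀ (X : Type u) [AddCommGroup X] [Module R X] [Module.Finite R X],
      ∀ i > d, ExtVanish R X ω i)
    (hdepth : moduleDepth R ω = d) (hdim : ringKrullDim R = (d : ℕ∞))
    (htype : Nonempty (Ext (ModuleCat.of R (ResidueField R)) (ModuleCat.of R ω) d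
      ≃ₗ[R] ResidueField R)) :
    (∀ φ : ω →ₗ[R] ω, ∃ r : R, φ = r • LinearMap.id) ∧
      ∀ r : R, r • (LinearMap.id : ω →ₗ[R] ω) = 0 → r = 0 := by
  obtain ⟨rs, hlen, hmem, hreg⟩ := exists_isRegular_length_eq_of_moduleDepth_eq hdepth
  exact homothety_lift LinearMap.id ⊥ (by simp) hmem hreg.toIsWeaklyRegular
    (exists_eq_smul_mkQ hvan hmem hreg hlen hdepth hdim htype)
    fun r hr => by
      rw [bot_sup_eq]
      exact mem_ofList_of_smul_mkQ_eq_zero hvan hmem hreg hlen hdepth hr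

end CanonicalEndomorphisms

/-! ### Finite projective dimension and Tor-independence of `ω` and of its duals -/

section TensorIndependence

open IsLocalRing

variable {R : Type u} [CommRing R]
variable {ω : Type u} [AddCommGroup ω] [Module R ω]

theorem rTensor_injective_of_leftInverse {A B T : Type u} [AddCommGroup A] [Module R A]
    [AddCommGroup B] [Module R B] [AddCommGroup T] [Module R T] {f : A →ₗ[R] B} {p : B →ₗ[R] A}
    (h : p ∘ₗ f = LinearMap.id) : Function.Injective (f.rTensor T) := by
  have h1 : p.rTensor T ∘ₗ f.rTensor T = LinearMap.id := by
    rw [← LinearMap.rTensor_comp, h, LinearMap.rTensor_id]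
  exact Function.LeftInverse.injective (g := p.rTensor T) (LinearMap.congr_fun h1)

theorem rTensor_ker_subtype_injective_of_projective {F M T : Type u} [AddCommGroup F] [Module R F]
    [AddCommGroup M] [Module R M] [AddCommGroup T] [Module R T] [Module.Projective R M]
    {π : F →ₗ[R] M} (hπ : Function.Surjective π) :
    Function.Injective ((LinearMap.ker π).subtype.rTensor T) := by
  obtain ⟨s, hs⟩ := Module.projective_lifting_property π LinearMap.id hπ
  have hmem : ∀ x, (LinearMap.id - s ∘ₗ π : F →ₗ[R] F) x ∈ LinearMap.ker π := by
    intro x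
    have := LinearMap.congr_fun hs (π x)
    simp only [LinearMap.comp_apply, LinearMap.id_apply] at this
    simp [this]
  refine rTensor_injective_of_leftInverse
    (p := (LinearMap.id - s ∘ₗ π : F →ₗ[R] F).codRestrict _ hmem) ?_
  ext x
  simp

/-- Tensor products of a family of retracts: if the identity of `W` factors through `ωⁿ`, then
injectivity of `f ⊗ ω` gives injectivity of `f ⊗ W`. -/
theorem rTensor_injective_of_sum_eq_id {A B W : Type u} [AddCommGroup A] [Module R A]
    [AddCommGroup B] [Module R B] [AddCommGroup W] [Module R W] {f : A →ₗ[R] B}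
    (h : Function.Injective (f.rTensor ω)) {n : ℕ} (p : Fin n → W →ₗ[R] ω) (s : Fin n → ω →ₗ[R] W)
    (hps : ∑ i, s i ∘ₗ p i = LinearMap.id) : Function.Injective (f.rTensor W) := by
  rw [← LinearMap.ker_eq_bot, LinearMap.ker_eq_bot']
  intro z hz
  have hp : ∀ i, (p i).lTensor A z = 0 := by
    intro i
    apply h
    rw [map_zero, ← LinearMap.comp_apply, LinearMap.rTensor_comp_lTensor,
      ← LinearMap.lTensor_comp_rTensor, LinearMap.comp_apply, hz, map_zero]
  have hz' : z = ∑ i, (s i).lTensor A ((p i).lTensor A z) := by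
    have : (∑ i, (s i).lTensor A ∘ₗ (p i).lTensor A) = LinearMap.id := by
      simp_rw [← LinearMap.lTensor_comp]
      have := congrArg (LinearMap.lTensorHom A) hps
      rw [map_sum] at this
      exact this.trans (LinearMap.lTensor_id A W)
    simpa using (LinearMap.congr_fun this z).symm
  rw [hz']
  simp [hp]

/-- Symmetry of the vanishing of `Tor_1`. -/
theorem lTensor_injective_of_rTensor_injective {L G K T W T' : Type u} [AddCommGroup L] [Module R L]
    [AddCommGroup G] [Module R G] [AddCommGroup K] [Module R K] [AddCommGroup T] [Module R T]
    [AddCommGroup W] [Module R W] [AddCommGroup T'] [Module R T'] [Module.Flat R G]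
    {j : L →ₗ[R] G} {ρ : G →ₗ[R] K} (hjρ : Function.Exact j ρ) (hρ : Function.Surjective ρ)
    {α : T →ₗ[R] W} {β : W →ₗ[R] T'} (hα : Function.Injective α) (hαβ : Function.Exact α β)
    (hβ : Function.Surjective β) (h : Function.Injective (j.rTensor T')) :
    Function.Injective (α.lTensor K) := by
  rw [← LinearMap.ker_eq_bot, LinearMap.ker_eq_bot']
  intro z hz
  obtain ⟨z, rfl⟩ := LinearMap.rTensor_surjective T hρ z
  have h1 : ρ.rTensor W (α.lTensor G z) = 0 := by
    rw [← hz, ← LinearMap.comp_apply, LinearMap.rTensor_comp_lTensor,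
      ← LinearMap.lTensor_comp_rTensor, LinearMap.comp_apply]
  obtain ⟨u, hu⟩ := (rTensor_exact W hjρ hρ _).mp h1
  have h2 : β.lTensor L u = 0 := by
    apply h
    rw [map_zero, ← LinearMap.comp_apply, LinearMap.rTensor_comp_lTensor,
      ← LinearMap.lTensor_comp_rTensor, LinearMap.comp_apply, hu]
    exact (lTensor_exact G hαβ hβ _).mpr ⟨z, rfl⟩
  obtain ⟨v, rfl⟩ := (lTensor_exact L hαβ hβ _).mp h2
  have h3 : j.rTensor T v = z := by
    apply Module.Flat.lTensor_preserves_injective_linearMap (M := G) α hα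
    rw [← hu, ← LinearMap.comp_apply, LinearMap.lTensor_comp_rTensor,
      ← LinearMap.rTensor_comp_lTensor, LinearMap.comp_apply]
  rw [← h3]
  exact (rTensor_exact T hjρ hρ _).mpr ⟨v, rfl⟩

/-- `Rⁿ ⊗ T` is `Tⁿ`. -/
noncomputable def piTensorEquiv (R T : Type u) [CommRing R] [AddCommGroup T] [Module R T] (n : ℕ) :
    (Fin n → R) ⊗[R] T ≃ₗ[R] (Fin n → T) :=
  (TensorProduct.comm R _ _).trans (TensorProduct.piScalarRight R R T (Fin n))

theorem mk_pi_bijective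
    (h1 : ∀ φ : ω →ₗ[R] ω, ∃ r : R, φ = r • LinearMap.id)
    (h2 : ∀ r : R, r • (LinearMap.id : ω →ₗ[R] ω) = 0 → r = 0) (n : ℕ) :
    Function.Bijective (TensorProduct.mk R (Fin n → R) ω) := by
  let e := piTensorEquiv R ω n
  have he : ∀ (x : Fin n → R) (w : ω) (i : Fin n), e (x ⊗ₜ w) i = x i • w := by
    intro x w i
    simp [e, piTensorEquiv]
  constructor
  · refine (injective_iff_map_eq_zero (TensorProduct.mk R (Fin n → R) ω)).mpr fun x hx => ?_
    ext i
    refine h2 _ ?_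
    ext w
    have := congrFun (congrArg e (LinearMap.congr_fun hx w)) i
    rw [TensorProduct.mk_apply, he] at this
    simpa using this
  · intro φ
    choose r hr using fun i => h1 (LinearMap.proj i ∘ₗ e.toLinearMap ∘ₗ φ)
    refine ⟨r, ?_⟩
    ext w
    apply e.injective
    ext i
    rw [TensorProduct.mk_apply, he]
    simpa using (LinearMap.congr_fun (hr i) w).symm

variable {M : Type u} [AddCommGroup M] [Module R M]

theorem mk_bijective_congr {F : Type u} [AddCommGroup F] [Module R F] (e : M ≃ₗ[R] F)
    (h : Function.Bijective (TensorProduct.mk R F ω)) :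
    Function.Bijective (TensorProduct.mk R M ω) := by
  have hcomm : ∀ m, e.toLinearMap.rTensor ω ∘ₗ TensorProduct.mk R M ω m =
      TensorProduct.mk R F ω (e m) := by
    intro m; ext w; simp
  have hinj : Function.Injective (e.toLinearMap.rTensor ω) := (e.rTensor ω).injective
  constructor
  · intro a b hab
    apply e.injective
    apply h.1
    rw [← hcomm, ← hcomm, hab]
  · intro φ
    obtain ⟨x, hx⟩ := h.2 (e.toLinearMap.rTensor ω ∘ₗ φ)
    obtain ⟨m, rfl⟩ := e.surjective x
    refine ⟨m, (LinearMap.cancel_left hinj).mp ?_⟩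
    rw [hcomm, hx]

variable [IsNoetherianRing R] [Module.Finite R ω] [Module.Finite R M]

omit [IsNoetherianRing R] [Module.Finite R M] in
theorem hasProjectiveDimensionLT_ker {n m : ℕ} {π : (Fin m → R) →ₗ[R] M}
    (hπ : Function.Surjective π) (h : HasProjectiveDimensionLT (ModuleCat.of R M) (n + 2)) :
    HasProjectiveDimensionLT (ModuleCat.of R (LinearMap.ker π)) (n + 1) :=
  (LinearMap.shortExact_shortComplexKer hπ).hasProjectiveDimensionLT_X₁ (n + 1)
    (inferInstanceAs (HasProjectiveDimensionLT (ModuleCat.of R (Fin m → R)) (n + 1))) h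

omit [IsNoetherianRing R] in
theorem exists_linearEquiv_fin_of_free [Module.Free R M] [Nontrivial R] :
    ∃ n : ℕ, Nonempty (M ≃ₗ[R] (Fin n → R)) :=
  ⟨_, ⟨(Module.finBasis R M).equivFun⟩⟩

section Step

variable {m : ℕ} {K : Type u} [AddCommGroup K] [Module R K] [Module.Finite R K]
  {ι : K →ₗ[R] (Fin m → R)} {π : (Fin m → R) →ₗ[R] M} (hι : Function.Injective ι)
  (hιπ : Function.Exact ι π) (hπ : Function.Surjective π)
  (h1 : ∀ φ : ω →ₗ[R] ω, ∃ r : R, φ = r • LinearMap.id)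
  (h2 : ∀ r : R, r • (LinearMap.id : ω →ₗ[R] ω) = 0 → r = 0)
  (hK : Function.Bijective (TensorProduct.mk R K ω))

include hι h1 h2 hK in
-- Let `Z` be the kernel of `ι ⊗ ω`. A map `ω → Z` is tensoring with some `x ∈ K`, and `ι x = 0`, so
-- `Hom(ω, Z) = 0`. Then some annihilator of `ω` is regular on `Z`; since `ω` is faithful it is `0`,
-- and `Z = 0`.
theorem rTensor_injective_of_mk_bijective :
    Function.Injective (ι.rTensor ω) := by
  set f := ι.rTensor ω with hf
  have hF := mk_pi_bijective h1 h2 m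
  have h3 : Subsingleton (ω →ₗ[R] LinearMap.ker f) := by
    refine subsingleton_of_forall_eq 0 fun φ => ?_
    obtain ⟨x, hx⟩ := hK.2 ((LinearMap.ker f).subtype ∘ₗ φ)
    have hx0 : TensorProduct.mk R (Fin m → R) ω (ι x) = 0 := by
      ext w
      have : f (TensorProduct.mk R (K) ω x w) = 0 := by
        rw [hx]; exact (φ w).2
      simpa [hf] using this
    have hx1 : x = 0 := hι ((hF.1 (hx0.trans (map_zero _).symm)).trans (map_zero ι).symm)
    refine (LinearMap.cancel_left (LinearMap.ker f).subtype_injective).mp ?_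
    rw [← hx, hx1, map_zero, LinearMap.comp_zero]
  obtain ⟨r, hr, hreg⟩ := IsSMulRegular.subsingleton_linearMap_iff.mp h3
  have hr0 : r = 0 := h2 r (by ext w; exact Module.mem_annihilator.mp hr w)
  rw [hr0, IsSMulRegular.zero_iff_subsingleton] at hreg
  rw [← LinearMap.ker_eq_bot]
  exact Submodule.subsingleton_iff_eq_bot.mp hreg

omit [IsNoetherianRing R] [Module.Finite R ω] [Module.Finite R M] [Module.Finite R K] in
include hιπ hπ h1 h2 hK in
-- The five lemma, comparing `0 → K → F → M → 0` with `Hom(ω, - ⊗ ω)` of it; the bottom row is right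
-- exact because `Ext^1(ω, K ⊗ ω) = 0`.
theorem mk_bijective_of_exact
    (hinj : Function.Injective (ι.rTensor ω))
    (hext : ExtVanish R ω (K ⊗[R] ω) 1) :
    Function.Bijective (TensorProduct.mk R M ω) := by
  have hF := mk_pi_bijective h1 h2 m
  have hex : Function.Exact (ι.rTensor ω) (π.rTensor ω) :=
    rTensor_exact ω hιπ hπ
  have hcomm : ∀ x, π.rTensor ω ∘ₗ TensorProduct.mk R (Fin m → R) ω x =
      TensorProduct.mk R M ω (π x) := by
    intro x; ext w; simp
  constructor
  · refine (injective_iff_map_eq_zero (TensorProduct.mk R M ω)).mpr fun a ha => ?_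
    obtain ⟨x, rfl⟩ := hπ a
    obtain ⟨ψ, hψ⟩ := exists_comp_eq_of_exact hinj hex ((hcomm x).trans ha)
    obtain ⟨k, rfl⟩ := hK.2 ψ
    have : TensorProduct.mk R (Fin m → R) ω (ι k) = TensorProduct.mk R (Fin m → R) ω x := by
      rw [← hψ]; ext w; simp
    rw [← hF.1 this]
    exact (hιπ _).mpr ⟨k, rfl⟩
  · intro φ
    obtain ⟨ψ, hψ⟩ := hext.exists_lift hinj hex (LinearMap.rTensor_surjective ω hπ) φ
    obtain ⟨x, rfl⟩ := hF.2 ψ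
    exact ⟨π x, by rw [← hcomm, hψ]⟩

end Step

variable [IsLocalRing R]

omit [IsNoetherianRing R] in
theorem free_of_hasProjectiveDimensionLT_one
    (h : HasProjectiveDimensionLT (ModuleCat.of R M) 1) : Module.Free R M := by
  have h1 : Projective (ModuleCat.of R M) := projective_iff_hasProjectiveDimensionLT_one.mpr h
  have : Module.Projective R M := (IsProjective.iff_projective M).mpr h1
  exact Module.free_of_flat_of_isLocalRing

/-- Modules of finite projective dimension lie in the Auslander class of a canonical module. -/
theorem mk_bijective_and_extVanish_of_hasProjectiveDimensionLT
    (h1 : ∀ φ : ω →ₗ[R] ω, ∃ r : R, φ = r • LinearMap.id)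
    (h2 : ∀ r : R, r • (LinearMap.id : ω →ₗ[R] ω) = 0 → r = 0)
    (hω : ∀ i, ExtVanish R ω ω (i + 1)) {n : ℕ}
    (hM : HasProjectiveDimensionLT (ModuleCat.of R M) (n + 1)) :
    Function.Bijective (TensorProduct.mk R M ω) ∧ ∀ i, ExtVanish R ω (M ⊗[R] ω) (i + 1) := by
  have hF : ∀ m i, ExtVanish R ω ((Fin m → R) ⊗[R] ω) (i + 1) := fun m i =>
    ((hω i).pi_fin m).congr_right (piTensorEquiv R ω m)
  induction n generalizing M with
  | zero =>
    have : Module.Free R M := free_of_hasProjectiveDimensionLT_one hM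
    obtain ⟨m, ⟨e⟩⟩ := exists_linearEquiv_fin_of_free (R := R) (M := M)
    exact ⟨mk_bijective_congr e (mk_pi_bijective h1 h2 m),
      fun i => (hF m i).congr_right (e.rTensor ω)⟩
  | succ n ih =>
    obtain ⟨m, π, hπ⟩ := Module.Finite.exists_fin' R M
    obtain ⟨hK1, hK2⟩ := ih (hasProjectiveDimensionLT_ker hπ hM)
    have hinj := rTensor_injective_of_mk_bijective (LinearMap.ker π).subtype_injective h1 h2 hK1
    refine ⟨mk_bijective_of_exact (LinearMap.exact_subtype_ker_map π) hπ h1 h2 hK1 hinj (hK2 0), fun i => ?_⟩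
    exact ExtVanish.cov_right hinj (rTensor_exact ω (LinearMap.exact_subtype_ker_map π) hπ)
      (LinearMap.rTensor_surjective ω hπ) (hF m i) (hK2 (i + 1))

theorem rTensor_ker_subtype_injective_canonical
    (h1 : ∀ φ : ω →ₗ[R] ω, ∃ r : R, φ = r • LinearMap.id)
    (h2 : ∀ r : R, r • (LinearMap.id : ω →ₗ[R] ω) = 0 → r = 0)
    (hω : ∀ i, ExtVanish R ω ω (i + 1)) {n : ℕ}
    (hM : HasProjectiveDimensionLT (ModuleCat.of R M) (n + 1)) {m : ℕ}
    {π : (Fin m → R) →ₗ[R] M} (hπ : Function.Surjective π) :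
    Function.Injective ((LinearMap.ker π).subtype.rTensor ω) := by
  rcases n with _ | n
  · have : Module.Free R M := free_of_hasProjectiveDimensionLT_one hM
    exact rTensor_ker_subtype_injective_of_projective hπ
  · exact rTensor_injective_of_mk_bijective (LinearMap.ker π).subtype_injective h1 h2
      (mk_bijective_and_extVanish_of_hasProjectiveDimensionLT h1 h2 hω
        (hasProjectiveDimensionLT_ker hπ hM)).1

/-- If `Ext^i(N, ω)` vanishes for `i > 0`, then `Hom(N, ω)` is `Tor`-independent of all modules of
finite projective dimension. -/
theorem rTensor_ker_subtype_injective_dual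
    (h1 : ∀ φ : ω →ₗ[R] ω, ∃ r : R, φ = r • LinearMap.id)
    (h2 : ∀ r : R, r • (LinearMap.id : ω →ₗ[R] ω) = 0 → r = 0)
    (hω : ∀ i, ExtVanish R ω ω (i + 1)) {n : ℕ}
    (hM : HasProjectiveDimensionLT (ModuleCat.of R M) (n + 1)) {m : ℕ}
    {π : (Fin m → R) →ₗ[R] M} (hπ : Function.Surjective π)
    {N : Type u} [AddCommGroup N] [Module R N] [Module.Finite R N]
    (hN : ∀ i, ExtVanish R N ω (i + 1)) :
    Function.Injective ((LinearMap.ker π).subtype.rTensor (N →ₗ[R] ω)) := by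
  -- The step replaces `M` by its syzygy and `N` by the syzygy `ker p`: `Tor_1(M, N^∨)` is
  -- controlled by `Tor_1(M, ω^a)` and `Tor_2(M, (ker p)^∨) = Tor_1(ker π, (ker p)^∨)`.
  induction n generalizing M m N with
  | zero =>
    have : Module.Free R M := free_of_hasProjectiveDimensionLT_one hM
    exact rTensor_ker_subtype_injective_of_projective hπ
  | succ n ih =>
    obtain ⟨a, p, hp⟩ := Module.Finite.exists_fin' R N
    obtain ⟨b, ρ, hρ⟩ := Module.Finite.exists_fin' R (LinearMap.ker π)
    have hp0 := LinearMap.exact_subtype_ker_map p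
    have hN' : ∀ i, ExtVanish R (LinearMap.ker p) ω (i + 1) := fun i =>
      ExtVanish.contra_left (LinearMap.ker p).subtype_injective hp0 hp
        (extVanish_of_projective i) (hN (i + 1))
    have hK := hasProjectiveDimensionLT_ker hπ hM
    have h3 := ih hK hρ hN'
    let α : (N →ₗ[R] ω) →ₗ[R] ((Fin a → R) →ₗ[R] ω) := LinearMap.lcomp R ω p
    let β : ((Fin a → R) →ₗ[R] ω) →ₗ[R] (LinearMap.ker p →ₗ[R] ω) :=
      LinearMap.lcomp R ω (LinearMap.ker p).subtype
    have hα : Function.Injective α := fun f g hfg => (LinearMap.cancel_right hp).mp hfg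
    have hβ : Function.Surjective β := fun f =>
      (hN 0).exists_extend (LinearMap.ker p).subtype_injective hp0 hp f
    have hαβ : Function.Exact α β := by
      intro f
      constructor
      · intro hf
        have hle : LinearMap.ker p ≤ LinearMap.ker f := fun x hx => LinearMap.congr_fun hf ⟨x, hx⟩
        refine ⟨(LinearMap.ker p).liftQ f hle ∘ₗ
          (p.quotKerEquivOfSurjective hp).symm.toLinearMap, ?_⟩
        refine LinearMap.ext fun x => ?_
        show (LinearMap.ker p).liftQ f hle ((p.quotKerEquivOfSurjective hp).symm
          (p.quotKerEquivOfSurjective hp (Submodule.Quotient.mk x))) = f x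
        rw [LinearEquiv.symm_apply_apply]
        rfl
      · rintro ⟨g, rfl⟩
        ext x
        show g (p x) = 0
        rw [x.2, map_zero]
    have h4 := lTensor_injective_of_rTensor_injective (LinearMap.exact_subtype_ker_map ρ) hρ
      hα hαβ hβ h3
    have h5 : Function.Injective ((LinearMap.ker π).subtype.rTensor ((Fin a → R) →ₗ[R] ω)) := by
      refine rTensor_injective_of_sum_eq_id
        (rTensor_ker_subtype_injective_canonical h1 h2 hω hM hπ)
        (fun i => LinearMap.proj i ∘ₗ (LinearEquiv.piRing R ω (Fin a) R).toLinearMap)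
        (fun i => (LinearEquiv.piRing R ω (Fin a) R).symm.toLinearMap ∘ₗ
          LinearMap.single R (fun _ => ω) i) ?_
      refine LinearMap.ext fun f => ?_
      simp only [LinearMap.sum_apply, LinearMap.comp_apply, LinearEquiv.coe_coe,
        LinearMap.proj_apply, LinearMap.single_apply, ← map_sum, LinearMap.id_apply]
      rw [Finset.univ_sum_single, LinearEquiv.symm_apply_apply]
    -- Both routes from `ker π ⊗ N^∨` to `R^m ⊗ (R^a)^∨` agree, and the one through `ker π ⊗
    -- (R^a)^∨` is injective by `h4` and `h5`.
    have h6 : Function.Injective (α.lTensor (Fin m → R) ∘ₗ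
        (LinearMap.ker π).subtype.rTensor (N →ₗ[R] ω)) := by
      rw [LinearMap.lTensor_comp_rTensor, ← LinearMap.rTensor_comp_lTensor]
      exact h5.comp h4
    exact Function.Injective.of_comp h6

end TensorIndependence

/-! ### Depth of tensor products with modules of finite projective dimension -/

section DepthFormula

open Abelian IsLocalRing

variable {R : Type u} [CommRing R] [IsLocalRing R]
variable {M K T : Type u} [AddCommGroup M] [Module R M] [AddCommGroup K] [Module R K]
  [AddCommGroup T] [Module R T]

/-- A map from a free module `K` to `F` with image in `𝔪F` lies in `𝔪 Hom(K, F)`. -/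
theorem mem_maximalIdeal_smul_hom {F : Type u} [AddCommGroup F] [Module R F] [Module.Free R K]
    [Module.Finite R K] {ι : K →ₗ[R] F}
    (h : ∀ x, ι x ∈ maximalIdeal R • (⊤ : Submodule R F)) :
    ι ∈ maximalIdeal R • (⊤ : Submodule R (K →ₗ[R] F)) := by
  let b := Module.finBasis R K
  have hsum : ι = ∑ j, (LinearMap.smulRightₗ (b.coord j)) (ι (b j)) := by
    refine b.ext fun i => ?_
    simp [Finsupp.single_apply]
  rw [hsum]
  refine Submodule.sum_mem _ fun j _ => ?_
  have h1 := Submodule.mem_map_of_mem (f := LinearMap.smulRightₗ (b.coord j)) (h (b j))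
  rw [Submodule.map_smul''] at h1
  exact Submodule.smul_mono le_rfl le_top h1

/-- `𝔪` kills `Ext(κ, -)`, and the induced map is linear in `ι`. -/
theorem comp_mk₀_rTensor_eq_zero {F : Type u} [AddCommGroup F] [Module R F] {ι : K →ₗ[R] F}
    (h : ι ∈ maximalIdeal R • (⊤ : Submodule R (K →ₗ[R] F))) {i : ℕ}
    (e : Ext (ModuleCat.of R (ResidueField R)) (ModuleCat.of R (K ⊗[R] T)) i) :
    e.comp (Ext.mk₀ (ModuleCat.ofHom (ι.rTensor T))) (add_zero i) = 0 := by
  refine Submodule.smul_induction_on h (fun r hr f _ => ?_) fun f g hf hg => ?_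
  · have : ModuleCat.ofHom ((r • f).rTensor T) = r • ModuleCat.ofHom (f.rTensor T) := by
      rw [LinearMap.rTensor_smul]; rfl
    rw [this, Ext.mk₀_smul, Ext.comp_smul]
    exact smul_ext_eq_zero_of_left (maximalIdeal_smul_residueField hr) _
  · have : ModuleCat.ofHom ((f + g).rTensor T) =
        ModuleCat.ofHom (f.rTensor T) + ModuleCat.ofHom (g.rTensor T) := by
      rw [LinearMap.rTensor_add]; rfl
    rw [this, Ext.mk₀_add, Ext.comp_add, hf, hg, add_zero]

variable [IsNoetherianRing R] [Module.Finite R T]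

/-- By minimality `Ext^e(κ, K ⊗ T)`, a nonzero power of `Ext^e(κ, T)`, maps to zero in `Ext^e(κ, F ⊗
T)`. It therefore comes from `Ext^{e-1}(κ, M ⊗ T)`, which cannot vanish; for `e = 0` the zero map
would be injective on a nonzero module. -/
theorem moduleDepth_tensor_lt_of_free {m e : ℕ} {ι : K →ₗ[R] (Fin m → R)}
    {π : (Fin m → R) →ₗ[R] M} (hT : moduleDepth R T = e)
    [Module.Finite R M] [Module.Finite R K] [Nontrivial K] [Module.Free R K]
    (hinj : Function.Injective (ι.rTensor T)) (hιπ : Function.Exact ι π)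
    (hπ : Function.Surjective π)
    (hmin : ∀ x, ι x ∈ maximalIdeal R • (⊤ : Submodule R (Fin m → R))) :
    moduleDepth R (M ⊗[R] T) < e := by
  by_contra hlt
  rw [not_lt, le_moduleDepth_iff] at hlt
  obtain ⟨b, ⟨eK⟩⟩ := exists_linearEquiv_fin_of_free (R := R) (M := K)
  have hb : b ≠ 0 := by
    rintro rfl
    exact not_subsingleton K eK.toEquiv.subsingleton
  have hKT : ¬ ExtVanish R (ResidueField R) (K ⊗[R] T) e := fun hv =>
    not_extVanish_of_moduleDepth_eq hT (ExtVanish.of_pi_fin (hv.congr_right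
      ((eK.rTensor T).trans (piTensorEquiv R T b)).symm) hb)
  have hex : Function.Exact (ι.rTensor T) (π.rTensor T) := rTensor_exact T hιπ hπ
  have hsurj := LinearMap.rTensor_surjective T hπ
  apply hKT
  refine subsingleton_of_forall_eq 0 fun a => ?_
  have ha := comp_mk₀_rTensor_eq_zero (mem_maximalIdeal_smul_hom hmin) a
  rcases e with _ | e
  · have hm : Mono (ModuleCat.ofHom (ι.rTensor T)) := (ModuleCat.mono_iff_injective _).mpr hinj
    exact (injective_iff_map_eq_zero _).mp
      (Ext.postcomp_mk₀_injective_of_mono (ModuleCat.of R (ResidueField R))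
        (ModuleCat.ofHom (ι.rTensor T))) a ha
  · obtain ⟨x, hx⟩ := Ext.covariant_sequence_exact₁ (ModuleCat.of R (ResidueField R))
      (exactShortComplex_shortExact hinj hex hsurj) a ha rfl
    rw [← hx, (hlt e (Nat.lt_succ_self e)).elim x 0, Ext.zero_comp]

theorem le_moduleDepth_of_exact {A B C : Type u} [AddCommGroup A] [Module R A] [AddCommGroup B]
    [Module R B] [AddCommGroup C] [Module R C] [Module.Finite R A] [Module.Finite R B]
    [Module.Finite R C] {f : A →ₗ[R] B} {g : B →ₗ[R] C} (hf : Function.Injective f)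
    (hfg : Function.Exact f g) (hg : Function.Surjective g) {n : ℕ}
    (hB : ((n + 1 : ℕ) : ℕ∞) ≤ moduleDepth R B) (hC : (n : ℕ∞) ≤ moduleDepth R C) :
    ((n + 1 : ℕ) : ℕ∞) ≤ moduleDepth R A := by
  rw [le_moduleDepth_iff] at hB hC ⊢
  rintro (_ | i) hi
  · exact ExtVanish.cov_zero (hB 0 hi) hf
  · exact ExtVanish.cov_left hf hfg hg (hC i (by omega)) (hB (i + 1) hi)

/-- With `c = depth C`, `Ext^c(κ, B) = 0` embeds the nonzero `Ext^c(κ, C)` in `Ext^{c+1}(κ, A)`; the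
lower groups for `A` vanish. -/
theorem moduleDepth_eq_add_one_of_exact {A B C : Type u} [AddCommGroup A] [Module R A]
    [AddCommGroup B] [Module R B] [AddCommGroup C] [Module R C] [Module.Finite R A]
    [Module.Finite R B] [Module.Finite R C] {f : A →ₗ[R] B} {g : B →ₗ[R] C}
    (hf : Function.Injective f) (hfg : Function.Exact f g) (hg : Function.Surjective g)
    (h : moduleDepth R C < moduleDepth R B) : moduleDepth R A = moduleDepth R C + 1 := by
  obtain ⟨c, hc⟩ := ENat.ne_top_iff_exists.mp h.ne_top
  have hB : ((c + 1 : ℕ) : ℕ∞) ≤ moduleDepth R B := by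
    rw [← hc] at h
    exact_mod_cast Order.add_one_le_of_lt h
  have hA := le_moduleDepth_of_exact hf hfg hg hB hc.le
  rw [← hc]
  refine (moduleDepth_eq_of_extVanish (n := c + 1) (le_moduleDepth_iff.mp hA) fun hv => ?_).trans
    (by push_cast; rfl)
  exact not_extVanish_of_moduleDepth_eq hc.symm
    (ExtVanish.cov_right hf hfg hg (le_moduleDepth_iff.mp hB c (Nat.lt_succ_self c)) hv)

theorem moduleDepth_pi_tensor {m : ℕ} {n : ℕ} (h : (n : ℕ∞) ≤ moduleDepth R T) :
    (n : ℕ∞) ≤ moduleDepth R ((Fin m → R) ⊗[R] T) := by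
  rw [le_moduleDepth_iff] at h ⊢
  exact fun i hi => ((h i hi).pi_fin m).congr_right (piTensorEquiv R T m)

/-- If `T` is `Tor`-independent of the modules of finite projective dimension, then tensoring
with a module of finite projective dimension that is not free lowers the depth of `T`. -/
theorem moduleDepth_tensor_lt {e : ℕ} (hT : moduleDepth R T = e)
    (hind : ∀ (M : Type u) [AddCommGroup M] [Module R M] [Module.Finite R M] (n : ℕ),
      HasProjectiveDimensionLT (ModuleCat.of R M) (n + 1) → ∀ (m : ℕ) (π : (Fin m → R) →ₗ[R] M),
      Function.Surjective π → Function.Injective ((LinearMap.ker π).subtype.rTensor T))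
    {n : ℕ} [Module.Finite R M] (hM : HasProjectiveDimensionLT (ModuleCat.of R M) (n + 1))
    (hfree : ¬ Module.Free R M) : moduleDepth R (M ⊗[R] T) < e := by
  induction n generalizing M with
  | zero => exact absurd (free_of_hasProjectiveDimensionLT_one hM) hfree
  | succ n ih =>
    obtain ⟨⟨m, π⟩, hπ⟩ := exists_isMinimalFreeCover R M
    have hinj := hind M _ hM m π hπ.surjective
    have hex := LinearMap.exact_subtype_ker_map π
    by_cases hK : Module.Free R (LinearMap.ker π)
    · have hnt : Nontrivial (LinearMap.ker π) := by
        rw [Submodule.nontrivial_iff_ne_bot]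
        intro hbot
        exact hfree (Module.Free.of_equiv
          (LinearEquiv.ofBijective π ⟨LinearMap.ker_eq_bot.mp hbot, hπ.surjective⟩))
      exact moduleDepth_tensor_lt_of_free hT hinj hex hπ.surjective fun x => hπ.ker_le x.2
    -- If `M ⊗ T` had depth at least `e`, the depth lemma would give the same for the syzygy,
    -- against the induction hypothesis.
    · by_contra hge
      rw [not_lt] at hge
      have hKlt := ih (hasProjectiveDimensionLT_ker hπ.surjective hM) hK
      refine absurd hKlt (not_lt.mpr ?_)
      have hF : (e : ℕ∞) ≤ moduleDepth R ((Fin m → R) ⊗[R] T) := moduleDepth_pi_tensor hT.ge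
      rcases e with _ | e
      · simp
      · exact le_moduleDepth_of_exact hinj (rTensor_exact T hex hπ.surjective)
          (LinearMap.rTensor_surjective T hπ.surjective) hF
          (le_trans (Nat.cast_le.mpr (Nat.le_succ e)) hge)

theorem moduleDepth_firstSyzygy_tensor [Nontrivial T]
    (hind : ∀ (M : Type u) [AddCommGroup M] [Module R M] [Module.Finite R M] (n : ℕ),
      HasProjectiveDimensionLT (ModuleCat.of R M) (n + 1) → ∀ (m : ℕ) (π : (Fin m → R) →ₗ[R] M),
      Function.Surjective π → Function.Injective ((LinearMap.ker π).subtype.rTensor T))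
    {n : ℕ} [Module.Finite R M] (hM : HasProjectiveDimensionLT (ModuleCat.of R M) (n + 1))
    (hfree : ¬ Module.Free R M) :
    moduleDepth R (firstSyzygy R M ⊗[R] T) = moduleDepth R (M ⊗[R] T) + 1 := by
  obtain ⟨d, hd⟩ := ringKrullDim_eq_coe_nat (R := R)
  have hle : moduleDepth R T ≤ d := by
    rw [← WithBot.coe_le_coe, ← hd]
    exact moduleDepth_le_ringKrullDim
  obtain ⟨e, he⟩ := ENat.ne_top_iff_exists.mp (hle.trans_lt (ENat.natCast_lt_top d)).ne
  have hπ := (exists_isMinimalFreeCover R M).choose_spec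
  refine moduleDepth_eq_add_one_of_exact (hind M _ hM _ _ hπ.surjective)
    (rTensor_exact T (LinearMap.exact_subtype_ker_map _) hπ.surjective)
    (LinearMap.rTensor_surjective T hπ.surjective) ?_
  exact (moduleDepth_tensor_lt he.symm hind hM hfree).trans_le (moduleDepth_pi_tensor he.le)

end DepthFormula

/-! ### The theorem on derivation modules -/

theorem mainTheorem10 {k : Type v} [Field k] [CharZero k]
    {R : Type u} [CommRing R] [IsLocalRing R] [Algebra k R] [Algebra.EssFiniteType k R]
    (hR : IsCohenMacaulayLocalRing R)
    {ω : Type u} [AddCommGroup ω] [Module R ω] (hω : IsCanonicalModule R ω)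
    {N : Type u} [AddCommGroup N] [Module R N] (hN : IsMaximalCohenMacaulay R N) :
    (moduleDepth R (firstSyzygy R (Derivation k R R) ⊗[R] canonicalDual R ω N) ≠
        moduleDepth R (Derivation k R R ⊗[R] canonicalDual R ω N) + 1 →
      projectiveDimension (ModuleCat.of R (Derivation k R R)) < ⊤ →
      Module.Free R (Derivation k R R)) ∧
    (IsMaximalCohenMacaulay R (Derivation k R R ⊗[R] canonicalDual R ω N) →
      moduleDepth R (firstSyzygy R (Derivation k R R) ⊗[R] canonicalDual R ω N) ≠
        moduleDepth R (Derivation k R R ⊗[R] canonicalDual R ω N) + 1) := by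
  have hnoeth : IsNoetherianRing R := Algebra.EssFiniteType.isNoetherianRing k R
  have hωfin := hω.maximalCohenMacaulay.finite
  have hNfin := hN.finite
  obtain ⟨d, hd⟩ := ringKrullDim_eq_coe_nat (R := R)
  have hdepth : ∀ {X : Type u} [AddCommGroup X] [Module R X],
      (moduleDepth R X : WithBot ℕ∞) = ringKrullDim R → moduleDepth R X = d := by
    intro X _ _ h
    rw [hd] at h
    exact WithBot.coe_inj.mp h
  have hRd := hdepth hR
  have hωd := hdepth hω.maximalCohenMacaulay.depth_eq
  constructor
  · intro hne hpd
    by_contra hfree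
    apply hne
    rcases subsingleton_or_nontrivial (canonicalDual R ω N) with hT | hT
    · rw [moduleDepth_of_subsingleton, moduleDepth_of_subsingleton, top_add]
    obtain ⟨n, hn⟩ := (projectiveDimension_ne_top_iff _).mp hpd.ne
    obtain ⟨c, hc⟩ := (injectiveDimension_ne_top_iff _).mp hω.injectiveDimension_lt_top.ne
    have hc' : HasInjectiveDimensionLT (ModuleCat.of R ω) (c + 1) := hc
    have hvan : ∀ (X : Type u) [AddCommGroup X] [Module R X] [Module.Finite R X],
        ∀ i > d, ExtVanish R X ω i :=
      fun X _ _ _ i hi => extVanish_of_injectiveDimension_lt_top hRd (n := c + 1) hi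
    -- Applied both to `N` and to `ω` itself, whose self-Ext vanishing starts the Auslander class
    -- argument.
    have hMCM : ∀ {X : Type u} [AddCommGroup X] [Module R X], IsMaximalCohenMacaulay R X →
        ∀ i, ExtVanish R X ω (i + 1) := by
      intro X _ _ hX i
      have := hX.finite
      obtain ⟨rs, hlen, hmem, hreg⟩ :=
        exists_isRegular_length_eq_of_moduleDepth_eq (hdepth hX.depth_eq)
      exact ExtVanish.of_isWeaklyRegular_left hvan hmem hreg.toIsWeaklyRegular (by omega)
    obtain ⟨t, ht, htype⟩ := hω.type_one
    obtain rfl : t = d := Nat.cast_injective (R := ℕ∞) (ht.symm.trans hωd)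
    obtain ⟨h1, h2⟩ := canonical_homothety hvan hωd hd htype
    refine moduleDepth_firstSyzygy_tensor (fun M _ _ _ n hM m π hπ => ?_) hn hfree
    exact rTensor_ker_subtype_injective_dual h1 h2 (hMCM hω.maximalCohenMacaulay) hM hπ (hMCM hN)
  · intro hMCM heq
    rw [hdepth hMCM.depth_eq] at heq
    -- The equality now reads `depth = d + 1`: a zero module has depth `⊤`, a nonzero one at most
    -- `d`.
    rcases subsingleton_or_nontrivial
      (firstSyzygy R (Derivation k R R) ⊗[R] canonicalDual R ω N) with hS | hS
    · rw [moduleDepth_of_subsingleton] at heq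
      exact ENat.top_ne_natCast (d + 1) (by exact_mod_cast heq)
    · have hle := moduleDepth_le_ringKrullDim (R := R)
        (M := firstSyzygy R (Derivation k R R) ⊗[R] canonicalDual R ω N)
      rw [hd, WithBot.coe_le_coe, heq] at hle
      have : d + 1 ≤ d := by exact_mod_cast hle
      omega
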